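/- Let $A_{n,\alpha}$ ($0<\alpha\in\mathbb R$) be the ring of formal power series in $\mathbb R[[\xi_1,\dots,\xi_n]]$ with radius of convergence $>\alpha$ (i.e. converging absolutely on the polydisc of polyradius $(\rho,\dots,\rho)$ for some $\rho>\alpha$). Let $K$ be the $t$-adic completion of the field $\bigcup_k\mathbb R((t^{1/k}))$ of Puiseux series over $\mathbb R$, let $K^\circ$ be the set of its elements of $t$-adic norm $\le 1$, and let $$\mathcal R_{n,\alpha}:=(A_{n,\alpha}\otimes_{\mathbb R}K)\,\widehat{\ },\qquad \mathcal R^\circ_{n,\alpha}:=(A_{n,\alpha}\otimes_{\mathbb R}K^\circ)\,\widehat{\ }$$ ($t$-adic completions). Thus $\mathcal R_{n,\alpha}$ is the ring of sums $\sum_i f_i t^{\gamma_i}$ with $f_i\in A_{n,\alpha}$ and increasing $\gamma_i\in\mathbb Q$ that are finite in number or tend to $\infty$, and $\mathcal R^\circ_{n,\alpha}$ is the subring of those with all $\gamma_i\ge 0$. For a (linearly) ordered abelian group $G$ let $$\mathcal R_{n,\alpha}(G):=\Big\{\sum_{g\in I}f_g t^g : f_g\in A_{n,\alpha},\ I\subset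 G\text{ well ordered}\Big\},$$ and let $\mathcal R^\circ_{n,\alpha}(G)$ be the subring of those series in which only exponents $g\ge 0$ occur. **Theorem (Strong Noetherian Property).** Let $m,n\ge 0$, $\alpha>0$, $\xi=(\xi_1,\dots,\xi_m)$, $\eta=(\eta_1,\dots,\eta_n)$. (a) Let $f(\xi,\eta)=\sum_{\mu\in\mathbb N^n}\overline f_\mu(\xi)\eta^\mu\in\mathcal R_{m+n,\alpha}$, where $\overline f_\mu(\xi)$ denotes the coefficient of $\eta^\mu$ in $f$. Then $\overline f_\mu\in\mathcal R_{m,\alpha}$ for all $\mu$, and there are an integer $d\in\mathbb N$, a real number $\beta$ with $0<\beta\le\alpha$, a finite set $J\subset\{0,1,\dots,d\}^n$, and units $U_\mu(\xi,\eta)$ of the ring $\mathcal R^\circ_{m+n,\beta}$ $(\mu\in J)$ such that $$f=\sum_{\mu\in J}\overline f_\mu(\xi)\,\eta^\mu\,U_\mu(\xi,\eta)\quad\text{in }\mathcal R_{m+n,\beta}.$$ (b) The same holds, for every ordered abelian group $G$, with $\mathcal R_{m+n,\alpha}$, $\mathcal R_{m,\alpha}$, $\mathcal R_{m+n,\beta}$,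 $\mathcal R^\circ_{m+n,\beta}$ replaced by $\mathcal R_{m+n,\alpha}(G)$, $\mathcal R_{m,\alpha}(G)$, $\mathcal R_{m+n,\beta}(G)$, $\mathcal R^\circ_{m+n,\beta}(G)$. -/

import Mathlib

namespace AnalyticStructure

theorem summable_radius_mono {σ : Type*} (f : MvPowerSeries σ ℝ) {ρ τ : NNReal} (h : ρ ≤ τ)
    (hf : Summable fun ν : σ →₀ ℕ => |MvPowerSeries.coeff ν f| * (τ : ℝ) ^ ν.degree) :
    Summable fun ν : σ →₀ ℕ => |MvPowerSeries.coeff ν f| * (ρ : ℝ) ^ ν.degree := by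
  refine Summable.of_nonneg_of_le (fun ν => by positivity) (fun ν => ?_) hf
  gcongr

theorem summable_radius_mul {σ : Type*} (f g : MvPowerSeries σ ℝ) (ρ : NNReal)
    (hf : Summable fun ν : σ →₀ ℕ => |MvPowerSeries.coeff ν f| * (ρ : ℝ) ^ ν.degree)
    (hg : Summable fun ν : σ →₀ ℕ => |MvPowerSeries.coeff ν g| * (ρ : ℝ) ^ ν.degree) :
    Summable fun ν : σ →₀ ℕ => |MvPowerSeries.coeff ν (f * g)| * (ρ : ℝ) ^ ν.degree := by
  classical
  have hm := summable_sum_mul_antidiagonal_of_summable_mul (A := σ →₀ ℕ)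
    (f := fun ν => |MvPowerSeries.coeff ν f| * (ρ : ℝ) ^ ν.degree)
    (g := fun ν => |MvPowerSeries.coeff ν g| * (ρ : ℝ) ^ ν.degree)
    (hf.mul_of_nonneg hg (fun ν => by positivity) (fun ν => by positivity))
  refine Summable.of_nonneg_of_le (fun ν => by positivity) (fun ν => ?_) hm
  rw [MvPowerSeries.coeff_mul]
  refine (mul_le_mul_of_nonneg_right (Finset.abs_sum_le_sum_abs _ _) (by positivity)).trans
    (le_of_eq ?_)
  rw [Finset.sum_mul]
  refine Finset.sum_congr rfl fun p hp => ?_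
  rw [← Finset.HasAntidiagonal.mem_antidiagonal.1 hp, map_add, pow_add, abs_mul]
  ring

/-- `A σ α`: the ring `A_{n,α}` of real formal power series in the variables indexed by `σ` whose
(poly-)radius of convergence is `> α`, i.e. which converge absolutely on the polydisc of
polyradius `(ρ, …, ρ)` for some real `ρ > α`. -/
noncomputable def A (σ : Type*) (α : ℝ) : Subring (MvPowerSeries σ ℝ) where
  carrier := {f | ∃ ρ : NNReal, α < ρ ∧
    Summable fun ν : σ →₀ ℕ => |MvPowerSeries.coeff ν f| * (ρ : ℝ) ^ ν.degree}
  mul_mem' := by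
    rintro f g ⟨r, hr, hf⟩ ⟨s, hs, hg⟩
    exact ⟨min r s, by simp only [NNReal.coe_min]; exact lt_min hr hs,
      summable_radius_mul f g _ (summable_radius_mono f (min_le_left r s) hf)
        (summable_radius_mono g (min_le_right r s) hg)⟩
  one_mem' := by
    classical
    obtain ⟨n, hn⟩ := exists_nat_gt α
    refine ⟨n, by simpa using hn, ?_⟩
    refine summable_of_ne_finset_zero (s := {0}) fun ν hν => ?_
    have : ν ≠ 0 := by simpa using hν
    simp [MvPowerSeries.coeff_one, this]
  add_mem' := by
    rintro f g ⟨r, hr, hf⟩ ⟨s, hs, hg⟩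
    refine ⟨min r s, by simp only [NNReal.coe_min]; exact lt_min hr hs, ?_⟩
    refine Summable.of_nonneg_of_le (fun ν => by positivity) (fun ν => ?_)
      ((summable_radius_mono f (min_le_left r s) hf).add
        (summable_radius_mono g (min_le_right r s) hg))
    rw [map_add, ← add_mul]
    exact mul_le_mul_of_nonneg_right (abs_add_le _ _) (by positivity)
  zero_mem' := by
    obtain ⟨n, hn⟩ := exists_nat_gt α
    exact ⟨n, by simpa using hn, by simp⟩
  neg_mem' := by
    rintro f ⟨r, hr, hf⟩
    exact ⟨r, hr, by simpa using hf⟩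

section Hahn

variable (Γ : Type*) [AddCommGroup Γ] [LinearOrder Γ] [IsOrderedAddMonoid Γ]

/-- `RG Γ σ α`: the ring `𝓡_{n,α}(Γ)` of all series `∑_{γ ∈ I} f_γ t^γ` with `I ⊆ Γ` well ordered
and `f_γ ∈ A_{n,α}`. -/
noncomputable def RG (σ : Type*) (α : ℝ) : Subring (HahnSeries Γ (MvPowerSeries σ ℝ)) where
  carrier := {f | ∀ γ, f.coeff γ ∈ A σ α}
  mul_mem' := by
    intro f g hf hg γ
    rw [HahnSeries.coeff_mul]
    exact sum_mem fun p _ => mul_mem (hf _) (hg _)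
  one_mem' := by
    intro γ
    rw [HahnSeries.coeff_one]
    split_ifs
    exacts [one_mem _, zero_mem _]
  add_mem' := fun hf hg γ => add_mem (hf γ) (hg γ)
  zero_mem' := fun _ => zero_mem _
  neg_mem' := fun hf γ => neg_mem (hf γ)

/-- The Hahn series of (Gauss) norm at most one: those with no term `t^γ`, `γ < 0`. -/
def unitBall (B : Type*) [CommRing B] : Subring (HahnSeries Γ B) where
  carrier := {f | ∀ γ < 0, f.coeff γ = 0}
  mul_mem' := by
    intro f g hf hg γ hγ
    rw [HahnSeries.coeff_mul]
    refine Finset.sum_eq_zero fun p hp => ?_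
    have hp' : p.1 + p.2 = γ := (Finset.mem_antidiagonal.1 hp).2.2
    rcases lt_or_ge p.1 0 with h | h
    · rw [hf _ h, zero_mul]
    · have h2 : p.2 < 0 := by
        by_contra h3
        exact absurd (add_nonneg h (not_lt.1 h3)) (by rw [hp']; exact not_le.2 hγ)
      rw [hg _ h2, mul_zero]
  one_mem' := by
    intro γ hγ
    rw [HahnSeries.coeff_one, if_neg hγ.ne]
  add_mem' := by
    intro f g hf hg γ hγ
    rw [HahnSeries.coeff_add, hf γ hγ, hg γ hγ, add_zero]
  zero_mem' := fun _ _ => rfl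
  neg_mem' := by
    intro f hf γ hγ
    rw [HahnSeries.coeff_neg, hf γ hγ, neg_zero]

/-- `RGInt Γ σ α`: the ring `𝓡°_{n,α}(Γ)` of elements of `𝓡_{n,α}(Γ)` of norm at most one. -/
noncomputable def RGInt (σ : Type*) (α : ℝ) : Subring (HahnSeries Γ (MvPowerSeries σ ℝ)) :=
  RG Γ σ α ⊓ unitBall Γ (MvPowerSeries σ ℝ)

end Hahn

/-- The series `∑ f_γ t^γ` with rational exponents such that for every `c` only finitely many
`γ < c` have `f_γ ≠ 0`, that is, finite sums and sums `∑_i f_{γ_i} t^{γ_i}` with `γ_i → ∞`. -/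
def leftFinite (B : Type*) [CommRing B] : Subring (HahnSeries ℚ B) where
  carrier := {f | ∀ c : ℚ, {γ | γ ∈ f.support ∧ γ < c}.Finite}
  mul_mem' := by
    intro f g hf hg c
    rcases eq_or_ne f 0 with rfl | hf0
    · simp
    rcases eq_or_ne g 0 with rfl | hg0
    · simp
    refine ((hf (c - g.order)).add (hg (c - f.order))).subset ?_
    rintro γ ⟨hγ, hc⟩
    obtain ⟨a, ha, b, hb, rfl⟩ := HahnSeries.support_mul_subset hγ
    have h1 := HahnSeries.order_le_of_coeff_ne_zero (x := f) ha
    have h2 := HahnSeries.order_le_of_coeff_ne_zero (x := g) hb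
    simp only at hc
    exact ⟨a, ⟨ha, by linarith⟩, b, ⟨hb, by linarith⟩, rfl⟩
  one_mem' := by
    intro c
    refine (Set.finite_singleton (0 : ℚ)).subset ?_
    rintro γ ⟨hγ, -⟩
    by_contra h
    exact hγ (by rw [HahnSeries.coeff_one, if_neg (by simpa using h)])
  add_mem' := by
    intro f g hf hg c
    refine ((hf c).union (hg c)).subset ?_
    rintro γ ⟨hγ, hc⟩
    rcases HahnSeries.support_add_subset _ _ hγ with h | h
    exacts [Or.inl ⟨h, hc⟩, Or.inr ⟨h, hc⟩]
  zero_mem' := by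
    intro c
    simp
  neg_mem' := by
    intro f hf c
    simpa using hf c

/-- `R σ α`: the ring `𝓡_{n,α}`, the `t`-adic completion of `A_{n,α} ⊗_ℝ K`, where `K` is the
`t`-adic completion of the field of real Puiseux series. It consists of the series
`∑_i f_i t^{γ_i}` with `f_i ∈ A_{n,α}` and rational exponents `γ_i` which are either finite in number
or tend to infinity; see `mem_R_iff` for the description as a completion. -/
noncomputable def R (σ : Type*) (α : ℝ) : Subring (HahnSeries ℚ (MvPowerSeries σ ℝ)) :=
  RG ℚ σ α ⊓ leftFinite (MvPowerSeries σ ℝ)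

/-- `RInt σ α`: the ring `𝓡°_{n,α}`, the `t`-adic completion of `A_{n,α} ⊗_ℝ K°`, i.e. the elements of
`𝓡_{n,α}` of norm at most one. -/
noncomputable def RInt (σ : Type*) (α : ℝ) : Subring (HahnSeries ℚ (MvPowerSeries σ ℝ)) :=
  R σ α ⊓ unitBall ℚ (MvPowerSeries σ ℝ)

/-- `R σ α` is the `t`-adic closure, in the Hahn series with rational exponents, of the
finite sums of terms `a t^γ` with `a ∈ A σ α`. -/
theorem mem_R_iff {σ : Type*} {α : ℝ} (f : HahnSeries ℚ (MvPowerSeries σ ℝ)) :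
    f ∈ R σ α ↔ ∀ c : ℚ, ∃ g ∈ AddSubgroup.closure
      {h | ∃ γ : ℚ, ∃ a ∈ A σ α, h = HahnSeries.single γ a},
      ∀ γ < c, f.coeff γ = g.coeff γ := by
  classical
  constructor
  · rintro ⟨h1, h2⟩ c
    refine ⟨∑ γ ∈ (h2 c).toFinset, HahnSeries.single γ (f.coeff γ),
      sum_mem fun γ _ => AddSubgroup.subset_closure ⟨γ, _, h1 γ, rfl⟩, fun γ hγ => ?_⟩
    rw [HahnSeries.coeff_sum]
    by_cases h : γ ∈ f.support
    · rw [Finset.sum_eq_single γ, HahnSeries.coeff_single_same]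
      · intro b _ hb
        rw [HahnSeries.coeff_single_of_ne hb.symm]
      · intro h'
        exact absurd ((h2 c).mem_toFinset.2 ⟨h, hγ⟩) h'
    · have h0 : f.coeff γ = 0 := by simpa using h
      rw [h0]
      symm
      refine Finset.sum_eq_zero fun b hb => HahnSeries.coeff_single_of_ne ?_
      rintro rfl
      exact h ((h2 c).mem_toFinset.1 hb).1
  · intro h
    have hle : AddSubgroup.closure
        {h | ∃ γ : ℚ, ∃ a ∈ A σ α, h = HahnSeries.single γ a} ≤ (R σ α).toAddSubgroup := by
      rw [AddSubgroup.closure_le]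
      rintro _ ⟨γ, a, ha, rfl⟩
      refine ⟨fun δ => ?_, fun c => ?_⟩
      · rw [HahnSeries.coeff_single]
        split_ifs
        exacts [ha, zero_mem _]
      · refine (Set.finite_singleton γ).subset ?_
        rintro δ ⟨hδ, -⟩
        by_contra h'
        exact hδ (HahnSeries.coeff_single_of_ne h')
    refine ⟨fun γ => ?_, fun c => ?_⟩
    · obtain ⟨g, hg, he⟩ := h (γ + 1)
      rw [he γ (by linarith)]
      exact (hle hg).1 γ
    · obtain ⟨g, hg, he⟩ := h c
      refine ((hle hg).2 c).subset ?_
      rintro γ ⟨hγ, hc⟩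
      refine ⟨?_, hc⟩
      rw [HahnSeries.mem_support, ← he γ hc]
      exact hγ

section Expansion

variable {Γ : Type*} [LinearOrder Γ]

/-- `etaCoeff μ f` is the coefficient `f̄_μ(ξ)` in the expansion `f(ξ,η) = ∑_μ f̄_μ(ξ) η^μ`. The
variables `ξ` are indexed by `Fin m` and the variables `η` by `Fin n`, so that the coefficient of
`t^γ ξ^ν` in `f̄_μ` is the coefficient of `t^γ ξ^ν η^μ` in `f`. -/
noncomputable def etaCoeff {m n : ℕ} (μ : Fin n →₀ ℕ)
    (f : HahnSeries Γ (MvPowerSeries (Fin m ⊕ Fin n) ℝ)) :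
    HahnSeries Γ (MvPowerSeries (Fin m) ℝ) :=
  f.map (({ toFun := fun p ν => MvPowerSeries.coeff (ν.sumElim μ) p
            map_zero' := rfl } :
    ZeroHom (MvPowerSeries (Fin m ⊕ Fin n) ℝ) (MvPowerSeries (Fin m) ℝ)))

theorem coeff_coeff_etaCoeff {m n : ℕ} (μ : Fin n →₀ ℕ)
    (f : HahnSeries Γ (MvPowerSeries (Fin m ⊕ Fin n) ℝ)) (γ : Γ) (ν : Fin m →₀ ℕ) :
    MvPowerSeries.coeff ν ((etaCoeff μ f).coeff γ) =
      MvPowerSeries.coeff (ν.sumElim μ) (f.coeff γ) :=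
  rfl

/-- A series in `ξ` alone, regarded as a series in `ξ` and `η`. -/
noncomputable def inXi {m : ℕ} (n : ℕ) (g : HahnSeries Γ (MvPowerSeries (Fin m) ℝ)) :
    HahnSeries Γ (MvPowerSeries (Fin m ⊕ Fin n) ℝ) :=
  g.map (MvPowerSeries.rename (R := ℝ) (Sum.inl : Fin m → Fin m ⊕ Fin n))

/-- The monomial `η^μ`. -/
noncomputable def etaPow (Γ : Type*) [AddCommGroup Γ] [LinearOrder Γ] [IsOrderedAddMonoid Γ]
    (m : ℕ) {n : ℕ} (μ : Fin n →₀ ℕ) :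
    HahnSeries Γ (MvPowerSeries (Fin m ⊕ Fin n) ℝ) :=
  HahnSeries.C (MvPowerSeries.monomial ((0 : Fin m →₀ ℕ).sumElim μ) 1)

end Expansion

end AnalyticStructure

/-! ### Prime weights on monomials and the weighted norms they define. -/

namespace AnalyticStructure

open scoped ENNReal NNReal

/-! Give the variables distinct primes as weights, so that monomials are totally ordered by an
integer `W`, and use the `ℓ¹` norms with factors `W(ν)^{-K}`. Increasing `K` shrinks the polydisc,
and any given convergent series is eventually dominated by its monomial of least weight. Hence
division by finitely many series is a perturbation of division by their leading monomials, inverted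
by a Neumann series. Its formal solution does not depend on `K`, so one `K` serves all exponents of
a Hahn series (`hahn_division`).

Let `f_μ` be the part of `f` of degree `μ` in `η`. The core is that `f` lies in the module spanned
by the `f_μ` over the norm-one ring of some smaller polydisc (`exists_mem_partSpan`). Modulo this
module `f` is a remainder of repeated divisions; each nonzero remainder contributes a homogeneous
part with a leading monomial not divisible by the earlier ones, so Noetherianity for monomial ideals
stops the process.

Now write `f = ∑ a_μ f_μ` and let `J` be the finite set of indices used. Taking the parts with
degree outside `J` gives `f = ∑_{μ ∈ J} (1 + b_μ) f_μ`, where `b_μ` has no term of degree `0`. So `1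
+ b_μ` becomes a unit after a last shrinking (`exists_eq_sum_hPart_mul_unit`).

Both statements are proved together by abstracting the admissible sets of exponents into
`SupportClass`. -/

/-- A multiplicative injective weight on monomials, with values in the natural numbers. -/
structure MonomialWeight (σ : Type*) where
  /-- the weight of a monomial -/
  toFun : (σ →₀ ℕ) → ℕ
  map_add : ∀ a b, toFun (a + b) = toFun a * toFun b
  injective : Function.Injective toFun
  two_pow_le : ∀ ν, 2 ^ ν.degree ≤ toFun ν
  exists_le_pow : ∃ c : ℕ, ∀ ν, toFun ν ≤ c ^ ν.degree

instance (σ : Type*) : CoeFun (MonomialWeight σ) fun _ => (σ →₀ ℕ) → ℕ := ⟨MonomialWeight.toFun⟩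

theorem MonomialWeight.pos {σ : Type*} (W : MonomialWeight σ) (ν : σ →₀ ℕ) : 0 < W ν :=
  lt_of_lt_of_le (by positivity) (W.two_pow_le ν)

/-- The weight is `∏ p_i ^ ν_i` with distinct primes `p_i`; injectivity is unique factorization. -/
theorem exists_monomialWeight (σ : Type*) [Finite σ] : Nonempty (MonomialWeight σ) := by
  classical
  obtain ⟨n, ⟨e⟩⟩ := Finite.exists_equiv_fin σ
  have : Fintype σ := Fintype.ofFinite σ
  let p : σ → ℕ := fun i => Nat.nth Nat.Prime (e i)
  have hp : ∀ i, (p i).Prime := fun i => Nat.prime_nth_prime _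
  have hinj : Function.Injective p := fun i j h =>
    e.injective (Fin.ext (Nat.nth_injective Nat.infinite_setOfPred_prime h))
  have hfac : ∀ (ν : σ →₀ ℕ) (i : σ), (∏ j, p j ^ ν j).factorization (p i) = ν i := by
    intro ν i
    rw [Nat.factorization_prod (fun j _ => pow_ne_zero _ (hp j).ne_zero), Finsupp.finsetSum_apply,
      Finset.sum_eq_single i]
    · rw [Nat.factorization_pow]; simp [(hp i).factorization_self]
    · intro j _ hj
      rw [Nat.factorization_pow, (hp j).factorization]
      simp [hinj.ne hj]
    · simp
  have hdeg : ∀ ν : σ →₀ ℕ, ν.degree = ∑ i, ν i := fun ν => by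
    rw [Finsupp.degree_eq_sum]
  refine ⟨⟨fun ν => ∏ i, p i ^ ν i, fun a b => ?_, fun a b h => ?_, fun ν => ?_,
    ∑ i, p i, fun ν => ?_⟩⟩
  · simp [pow_add, Finset.prod_mul_distrib]
  · ext i
    rw [← hfac a i, ← hfac b i]
    exact congrArg (fun x : ℕ => x.factorization (p i)) h
  · rw [hdeg, ← Finset.prod_pow_eq_pow_sum]
    exact Finset.prod_le_prod' fun i _ => Nat.pow_le_pow_left (hp i).two_le _
  · rw [hdeg, ← Finset.prod_pow_eq_pow_sum]
    exact Finset.prod_le_prod' fun i _ => Nat.pow_le_pow_left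
      (Finset.single_le_sum (f := p) (fun _ _ => Nat.zero_le _) (Finset.mem_univ i)) _

section Norm

variable {σ : Type*} (W : MonomialWeight σ) (K : ℕ)

/-- The factor `W(ν)^{-K}`. -/
noncomputable def wt (ν : σ →₀ ℕ) : ℝ≥0 := ((W ν : ℝ≥0)⁻¹) ^ K

theorem wt_pos (ν : σ →₀ ℕ) : 0 < wt W K ν := by
  have : (0 : ℝ≥0) < W ν := by exact_mod_cast W.pos ν
  unfold wt; positivity

theorem wt_add (a b : σ →₀ ℕ) : wt W K (a + b) = wt W K a * wt W K b := by
  simp [wt, W.map_add, mul_comm, mul_pow]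

theorem wt_anti {K K' : ℕ} (h : K ≤ K') (ν : σ →₀ ℕ) : wt W K' ν ≤ wt W K ν := by
  have : (1 : ℝ≥0) ≤ W ν := by exact_mod_cast W.pos ν
  exact pow_le_pow_of_le_one (by positivity) (inv_le_one_of_one_le₀ this) h

/-- The weighted `ℓ¹` norm of a power series. -/
noncomputable def wnorm (p : MvPowerSeries σ ℝ) : ℝ≥0∞ :=
  ∑' ν, ‖MvPowerSeries.coeff ν p‖ₑ * (wt W K ν : ℝ≥0∞)

theorem wnorm_le_of_coeff {p q : MvPowerSeries σ ℝ}
    (h : ∀ ν, ‖MvPowerSeries.coeff ν p‖ₑ ≤ ‖MvPowerSeries.coeff ν q‖ₑ) :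
    wnorm W K p ≤ wnorm W K q :=
  ENNReal.tsum_le_tsum fun ν => mul_le_mul_left (h ν) _

theorem wnorm_zero : wnorm W K 0 = 0 := by simp [wnorm]

theorem wnorm_neg (p : MvPowerSeries σ ℝ) : wnorm W K (-p) = wnorm W K p := by simp [wnorm]

theorem wnorm_add_le (p q : MvPowerSeries σ ℝ) :
    wnorm W K (p + q) ≤ wnorm W K p + wnorm W K q := by
  unfold wnorm
  rw [← ENNReal.tsum_add]
  refine ENNReal.tsum_le_tsum fun ν => ?_
  rw [map_add, ← add_mul]
  gcongr
  exact enorm_add_le _ _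

theorem wnorm_sum_le {ι : Type*} (s : Finset ι) (p : ι → MvPowerSeries σ ℝ) :
    wnorm W K (∑ i ∈ s, p i) ≤ ∑ i ∈ s, wnorm W K (p i) := by
  classical
  induction s using Finset.induction_on with
  | empty => simp [wnorm_zero]
  | insert i s hi ih =>
    rw [Finset.sum_insert hi, Finset.sum_insert hi]
    exact (wnorm_add_le W K _ _).trans (by gcongr)

theorem wnorm_mul_le (p q : MvPowerSeries σ ℝ) :
    wnorm W K (p * q) ≤ wnorm W K p * wnorm W K q := by
  classical
  let F : (σ →₀ ℕ) × (σ →₀ ℕ) → ℝ≥0∞ := fun x =>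
    (‖MvPowerSeries.coeff x.1 p‖ₑ * (wt W K x.1 : ℝ≥0∞)) *
      (‖MvPowerSeries.coeff x.2 q‖ₑ * (wt W K x.2 : ℝ≥0∞))
  have h1 : wnorm W K p * wnorm W K q = ∑' x, F x := by
    rw [ENNReal.tsum_prod', wnorm, ← ENNReal.tsum_mul_right]
    refine tsum_congr fun a => ?_
    rw [wnorm, ← ENNReal.tsum_mul_left]
  rw [h1, ← (Finset.HasAntidiagonal.sigmaAntidiagonalEquivProd (A := σ →₀ ℕ)).tsum_eq F, ENNReal.tsum_sigma']
  refine ENNReal.tsum_le_tsum fun ν => ?_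
  simp only [Finset.HasAntidiagonal.sigmaAntidiagonalEquivProd_apply]
  rw [MvPowerSeries.coeff_mul, tsum_fintype,
    Finset.sum_coe_sort (Finset.HasAntidiagonal.antidiagonal ν) F]
  refine (mul_le_mul_left (enorm_sum_le _ _) _).trans (le_of_eq ?_)
  rw [Finset.sum_mul]
  refine Finset.sum_congr rfl fun x hx => ?_
  have hx' : x.1 + x.2 = ν := Finset.HasAntidiagonal.mem_antidiagonal.1 hx
  rw [← hx', wt_add, enorm_mul, ENNReal.coe_mul]
  simp only [F]
  ring

theorem wnorm_monomial (e : σ →₀ ℕ) (c : ℝ) :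
    wnorm W K (MvPowerSeries.monomial e c) = ‖c‖ₑ * (wt W K e : ℝ≥0∞) := by
  classical
  rw [wnorm, tsum_eq_single e]
  · rw [MvPowerSeries.coeff_monomial_same]
  · intro ν hν
    rw [MvPowerSeries.coeff_monomial_ne hν]
    simp

/-- The power series of finite weighted norm. -/
noncomputable def B : Subring (MvPowerSeries σ ℝ) where
  carrier := {p | wnorm W K p < ∞}
  mul_mem' := fun hp hq => (wnorm_mul_le W K _ _).trans_lt (ENNReal.mul_lt_top hp hq)
  one_mem' := by
    show wnorm W K 1 < ∞
    rw [← MvPowerSeries.monomial_zero_one, wnorm_monomial]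
    exact ENNReal.mul_lt_top (by simp) (by simp)
  add_mem' := fun hp hq => (wnorm_add_le W K _ _).trans_lt (ENNReal.add_lt_top.2 ⟨hp, hq⟩)
  zero_mem' := by simp [wnorm_zero]
  neg_mem' := fun {p} hp => by simpa [wnorm_neg] using hp

theorem mem_B {p : MvPowerSeries σ ℝ} : p ∈ B W K ↔ wnorm W K p < ∞ := Iff.rfl

variable {W K} in
theorem mem_B_of_coeff {p q : MvPowerSeries σ ℝ} (hq : q ∈ B W K)
    (h : ∀ ν, ‖MvPowerSeries.coeff ν p‖ₑ ≤ ‖MvPowerSeries.coeff ν q‖ₑ) : p ∈ B W K :=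
  (wnorm_le_of_coeff W K h).trans_lt hq

theorem B_mono : Monotone (B W) := fun _ _ h _ hp =>
  lt_of_le_of_lt (ENNReal.tsum_le_tsum fun ν => by gcongr; exact wt_anti W h ν) hp

/-- Since `W ν ≥ 2 ^ |ν|`, any `K` with `2^{-K} < α` gives weights below those of the polydisc of
radius `ρ > α`. -/
theorem exists_A_le_B {α : ℝ} (hα : 0 < α) : ∃ K, A σ α ≤ B W K := by
  obtain ⟨K, hK⟩ := exists_pow_lt_of_lt_one hα (by norm_num : (1 / 2 : ℝ) < 1)
  refine ⟨K, ?_⟩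
  rintro p ⟨ρ, hρ, hs⟩
  rw [mem_B, wnorm]
  have h2 : ∀ ν, wt W K ν ≤ ρ ^ ν.degree := by
    intro ν
    have h3 : ((1 / 2 : ℝ≥0)) ^ K ≤ ρ := by
      rw [← NNReal.coe_le_coe]
      push_cast
      exact (hK.trans hρ).le
    have h4 : (2 : ℝ≥0) ^ ν.degree ≤ W ν := by exact_mod_cast W.two_pow_le ν
    calc wt W K ν ≤ (((2 : ℝ≥0) ^ ν.degree)⁻¹) ^ K := by
          unfold wt; gcongr
      _ = ((1 / 2 : ℝ≥0) ^ K) ^ ν.degree := by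
          rw [← inv_pow, ← pow_mul, ← pow_mul, mul_comm, one_div]
      _ ≤ _ := by gcongr
  refine lt_of_le_of_lt (b := ∑' ν, ENNReal.ofReal (|MvPowerSeries.coeff ν p| * (ρ : ℝ) ^ ν.degree))
    (ENNReal.tsum_le_tsum fun ν => ?_) hs.tsum_ofReal_lt_top
  rw [ENNReal.ofReal_mul (abs_nonneg _), ← Real.enorm_eq_ofReal_abs]
  gcongr
  rw [← NNReal.coe_pow, ENNReal.ofReal_coe_nnreal]
  exact_mod_cast h2 ν

theorem exists_B_le_A {α : ℝ} (hα : 0 < α) : ∃ β : ℝ, 0 < β ∧ β ≤ α ∧ B W K ≤ A σ β := by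
  obtain ⟨c, hc⟩ := W.exists_le_pow
  let ρ : ℝ≥0 := ((c + 1 : ℝ≥0)⁻¹) ^ K
  have hρ : 0 < ρ := by positivity
  have hρ' : (0 : ℝ) < ρ := hρ
  -- Half of `ρ`, because membership in `A σ β` asks for convergence at a radius strictly above `β`.
  refine ⟨min α (ρ / 2), lt_min hα (by positivity), min_le_left _ _, ?_⟩
  intro p hp
  refine ⟨ρ, (min_le_right _ _).trans_lt (by linarith), ?_⟩
  have h2 : ∀ ν, ρ ^ ν.degree ≤ wt W K ν := by
    intro ν
    have h4 : (W ν : ℝ≥0) ≤ (c + 1) ^ ν.degree := by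
      exact_mod_cast (hc ν).trans (Nat.pow_le_pow_left (Nat.le_succ c) _)
    have h5 : (0 : ℝ≥0) < W ν := by exact_mod_cast W.pos ν
    calc ρ ^ ν.degree = (((c + 1 : ℝ≥0) ^ ν.degree)⁻¹) ^ K := by
          rw [← inv_pow, ← pow_mul, ← pow_mul, mul_comm]
      _ ≤ wt W K ν := by unfold wt; gcongr
  rw [mem_B, wnorm] at hp
  have hs := ENNReal.summable_toReal hp.ne
  refine Summable.of_nonneg_of_le (fun ν => by positivity) (fun ν => ?_) hs
  rw [ENNReal.toReal_mul, toReal_enorm, Real.norm_eq_abs]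
  gcongr
  exact_mod_cast h2 ν

end Norm

end AnalyticStructure

namespace AnalyticStructure

open scoped ENNReal NNReal

/-! ### Neumann series for operators that raise the weight. -/

section Perturbation

variable {σ : Type*} (W : MonomialWeight σ)

/-- The power series all of whose monomials have weight at least `M`. -/
def weightGE (M : ℕ) : AddSubgroup (MvPowerSeries σ ℝ) where
  carrier := {p | ∀ ν, W ν < M → MvPowerSeries.coeff ν p = 0}
  add_mem' := fun hp hq ν h => by rw [map_add, hp ν h, hq ν h, add_zero]
  zero_mem' := fun _ _ => rfl
  neg_mem' := fun hp ν h => by rw [map_neg, hp ν h, neg_zero]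

/-- An operator that strictly raises the weight can be inverted after adding the identity; the
inverse does not depend on the norm and is bounded for each norm in which the operator is
a contraction by the factor one half. -/
theorem exists_inverse_one_add (E : MvPowerSeries σ ℝ →+ MvPowerSeries σ ℝ)
    (hE : ∀ M, ∀ p ∈ weightGE W M, E p ∈ weightGE W (M + 1)) :
    ∃ S : MvPowerSeries σ ℝ → MvPowerSeries σ ℝ, (∀ p, S p + E (S p) = p) ∧ S 0 = 0 ∧
      ∀ K, (∀ p, wnorm W K (E p) ≤ 2⁻¹ * wnorm W K p) →
        ∀ p, wnorm W K (S p) ≤ 2 * wnorm W K p := by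
  let F : AddMonoid.End (MvPowerSeries σ ℝ) := -E
  have hF : ∀ k M p, p ∈ weightGE W M → (F ^ k) p ∈ weightGE W (M + k) := by
    intro k
    induction k with
    | zero => intro M p hp; exact hp
    | succ k ih =>
      intro M p hp
      rw [pow_succ']
      exact neg_mem (hE _ _ (ih M p hp))
  have hF0 : ∀ k p, (F ^ k) p ∈ weightGE W k := fun k p => by
    simpa using hF k 0 p (fun ν h => absurd h (Nat.not_lt_zero _))
  let T : ℕ → MvPowerSeries σ ℝ → MvPowerSeries σ ℝ := fun M p =>
    ∑ k ∈ Finset.range M, (F ^ k) p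
  have hT : ∀ M p, T M p + E (T M p) = p - (F ^ M) p := by
    intro M p
    induction M with
    | zero => simp [T]
    | succ M ih =>
      have h1 : T (M + 1) p = T M p + (F ^ M) p := Finset.sum_range_succ _ _
      have h2 : (F ^ (M + 1)) p = -E ((F ^ M) p) := by
        rw [pow_succ']; rfl
      rw [h1, map_add, h2, sub_neg_eq_add]
      linear_combination ih
  -- The Neumann series `∑ F^k p`, read coefficientwise: `F^k p` has no monomial of weight below
  -- `k`, so at `ν` only `k ≤ W ν` contributes.
  let S : MvPowerSeries σ ℝ → MvPowerSeries σ ℝ := fun p ν =>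
    ∑ k ∈ Finset.range (W ν + 1), MvPowerSeries.coeff ν ((F ^ k) p)
  have hST : ∀ M p, S p - T M p ∈ weightGE W M := by
    intro M p ν hν
    have h1 : MvPowerSeries.coeff ν (S p) =
      ∑ k ∈ Finset.range (W ν + 1), MvPowerSeries.coeff ν ((F ^ k) p) := rfl
    rw [map_sub, h1, map_sum, sub_eq_zero]
    refine Finset.sum_subset (Finset.range_subset_range.2 hν) fun k _ hk => ?_
    exact hF0 k p ν (by simpa using hk)
  refine ⟨S, fun p => ?_, ?_, fun K hK p => ?_⟩
  · ext ν
    have h1 := hST (W ν + 1) p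
    have h2 := hE _ _ h1
    have h3 := h1 ν (Nat.lt_succ_self _)
    have h4 := h2 ν (by omega)
    have h5 := congrArg (MvPowerSeries.coeff ν) (hT (W ν + 1) p)
    have h6 := hF0 (W ν + 1) p ν (Nat.lt_succ_self _)
    simp only [map_add, map_sub] at *
    linarith
  · ext ν
    show ∑ k ∈ Finset.range (W ν + 1), MvPowerSeries.coeff ν ((F ^ k) 0) = 0
    simp
  · have hk : ∀ k, wnorm W K ((F ^ k) p) ≤ 2⁻¹ ^ k * wnorm W K p := by
      intro k
      induction k with
      | zero => simp
      | succ k ih =>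
        have h1 : (F ^ (k + 1)) p = -E ((F ^ k) p) := by rw [pow_succ']; rfl
        rw [h1, wnorm_neg, pow_succ', mul_assoc]
        exact (hK _).trans (by gcongr)
    calc wnorm W K (S p)
        ≤ ∑' ν, ∑' k, ‖MvPowerSeries.coeff ν ((F ^ k) p)‖ₑ * (wt W K ν : ℝ≥0∞) := by
          refine ENNReal.tsum_le_tsum fun ν => ?_
          rw [ENNReal.tsum_mul_right]
          gcongr
          exact (enorm_sum_le (Finset.range (W ν + 1))
            fun k => MvPowerSeries.coeff ν ((F ^ k) p)).trans (ENNReal.sum_le_tsum _)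
      _ = ∑' k, wnorm W K ((F ^ k) p) := ENNReal.tsum_comm
      _ ≤ ∑' k : ℕ, 2⁻¹ ^ k * wnorm W K p := ENNReal.tsum_le_tsum hk
      _ = 2 * wnorm W K p := by
          rw [ENNReal.tsum_mul_right, ENNReal.tsum_geometric, ENNReal.one_sub_inv_two, inv_inv]

end Perturbation

/-! ### Leading monomials and their dominance for large `K`. -/

section Tail

variable {σ : Type*} (W : MonomialWeight σ)

/-- `e` is the leading monomial of `b`: the monomial of smallest weight. -/
def IsLeading (b : MvPowerSeries σ ℝ) (e : σ →₀ ℕ) : Prop :=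
  MvPowerSeries.coeff e b ≠ 0 ∧ b ∈ weightGE W (W e)

theorem exists_isLeading {b : MvPowerSeries σ ℝ} (hb : b ≠ 0) : ∃ e, IsLeading W b e := by
  classical
  have h : ∃ N, ∃ e, W e = N ∧ MvPowerSeries.coeff e b ≠ 0 := by
    by_contra! h
    exact hb (MvPowerSeries.ext fun ν => by simpa using h _ ν rfl)
  obtain ⟨e, he, hb⟩ := Nat.find_spec h
  refine ⟨e, hb, fun ν hν => ?_⟩
  by_contra h'
  exact Nat.find_min h (he ▸ hν) ⟨ν, rfl, h'⟩

/-- The series without its leading term. -/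
noncomputable def tail (b : MvPowerSeries σ ℝ) (e : σ →₀ ℕ) : MvPowerSeries σ ℝ :=
  b - MvPowerSeries.monomial e (MvPowerSeries.coeff e b)

theorem coeff_tail [DecidableEq σ] (b : MvPowerSeries σ ℝ) (e ν : σ →₀ ℕ) :
    MvPowerSeries.coeff ν (tail b e) = if ν = e then 0 else MvPowerSeries.coeff ν b := by
  rw [tail, map_sub, MvPowerSeries.coeff_monomial]
  split_ifs with h
  · rw [h, sub_self]
  · rw [sub_zero]

variable {W}

theorem IsLeading.tail_mem {b : MvPowerSeries σ ℝ} {e : σ →₀ ℕ} (h : IsLeading W b e) :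
    tail b e ∈ weightGE W (W e + 1) := by
  classical
  intro ν hν
  rw [coeff_tail]
  split_ifs with h'
  · rfl
  · exact h.2 ν (lt_of_le_of_ne (Nat.lt_succ_iff.1 hν) (W.injective.ne h'))

/-- Weights are integers, so every other monomial of `b` has weight at least `W e + 1`. Raising `K`
by `d` thus multiplies the ratio of the tail to the leading monomial by at most `(W e / (W e + 1)) ^
d`. -/
theorem IsLeading.eventually_wnorm_tail_le {b : MvPowerSeries σ ℝ} {e : σ →₀ ℕ}
    (h : IsLeading W b e) {K₀ : ℕ} (hb : b ∈ B W K₀) {ε : ℝ≥0∞} (hε : 0 < ε) :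
    ∀ᶠ K in Filter.atTop, wnorm W K (tail b e) ≤ ε * (wt W K e : ℝ≥0∞) := by
  classical
  let r : ℝ≥0 := (W e : ℝ≥0) / (W e + 1)
  have hWe : (0 : ℝ≥0) < W e := by exact_mod_cast W.pos e
  have hr : r < 1 := by
    rw [div_lt_one (by positivity)]
    exact lt_add_one _
  have hkey : ∀ d ν, W e < W ν →
      wt W (K₀ + d) ν ≤ wt W K₀ ν * r ^ d * (wt W K₀ e)⁻¹ * wt W (K₀ + d) e := by
    intro d ν hν
    have hWν : (0 : ℝ≥0) < W ν := by exact_mod_cast W.pos ν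
    have h2 : (W e + 1 : ℝ≥0) ≤ W ν := by exact_mod_cast hν
    have h1 : ((W ν : ℝ≥0)⁻¹) ≤ r * (W e : ℝ≥0)⁻¹ := by
      have : r * (W e : ℝ≥0)⁻¹ = (W e + 1 : ℝ≥0)⁻¹ := by
        simp only [r]; field_simp
      rw [this]
      gcongr
    have h3 : (wt W K₀ e)⁻¹ * wt W (K₀ + d) e = ((W e : ℝ≥0)⁻¹) ^ d := by
      rw [wt, wt, pow_add, inv_mul_cancel_left₀ (by positivity)]
    rw [mul_assoc, h3, mul_assoc, ← mul_pow, wt, pow_add]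
    unfold wt
    gcongr
  have hb' : wnorm W K₀ b * ((wt W K₀ e)⁻¹ : ℝ≥0) ≠ ∞ :=
    ENNReal.mul_ne_top (ne_of_lt hb) ENNReal.coe_ne_top
  have hlim : Filter.Tendsto (fun d : ℕ => (r : ℝ≥0∞) ^ d *
      (wnorm W K₀ b * ((wt W K₀ e)⁻¹ : ℝ≥0))) Filter.atTop (nhds 0) := by
    have := ENNReal.Tendsto.mul_const
      (ENNReal.tendsto_pow_atTop_nhds_zero_of_lt_one (r := (r : ℝ≥0∞)) (by exact_mod_cast hr))
      (Or.inr hb')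
    simpa using this
  obtain ⟨d₀, hd₀⟩ := Filter.eventually_atTop.1 (hlim.eventually_le_const hε)
  filter_upwards [Filter.eventually_ge_atTop (K₀ + d₀)] with K hK
  obtain ⟨d, rfl⟩ := Nat.exists_eq_add_of_le (show K₀ ≤ K by omega)
  have hd := hd₀ d (by omega)
  refine le_trans ?_ (mul_le_mul_left hd _)
  rw [wnorm, wnorm, ← ENNReal.tsum_mul_right, ← ENNReal.tsum_mul_left, ← ENNReal.tsum_mul_right]
  refine ENNReal.tsum_le_tsum fun ν => ?_
  rw [coeff_tail]
  split_ifs with h'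
  · simp
  rcases lt_or_ge (W e) (W ν) with hlt | hge
  · have := hkey d ν hlt
    have : (wt W (K₀ + d) ν : ℝ≥0∞) ≤
      (wt W K₀ ν * r ^ d * ((wt W K₀ e)⁻¹ : ℝ≥0) * wt W (K₀ + d) e : ℝ≥0∞) := by
      exact_mod_cast this
    refine (mul_le_mul_right this _).trans (le_of_eq ?_)
    ring
  · rw [h.2 ν (lt_of_le_of_ne hge (W.injective.ne h'))]
    simp

end Tail

/-! ### Division of power series by finitely many series. -/

section FormalDivision

variable {σ ι : Type*} (e : ι → σ →₀ ℕ)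

open Classical in
/-- A choice of an index `j` with `e j ≤ ν`. -/
noncomputable def sel (ν : σ →₀ ℕ) : Option ι :=
  if h : ∃ j, e j ≤ ν then some h.choose else none

theorem le_of_sel {ν : σ →₀ ℕ} {j : ι} (h : sel e ν = some j) : e j ≤ ν := by
  unfold sel at h
  split_ifs at h with h'
  rw [← Option.some.inj h]
  exact h'.choose_spec

theorem not_le_of_sel {ν : σ →₀ ℕ} (h : sel e ν = none) (j : ι) : ¬ e j ≤ ν := by
  unfold sel at h
  split_ifs at h with h'
  exact fun hj => h' ⟨j, hj⟩

open Classical in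
/-- The quotients in the division by the monomials `c j ξ^(e j)`. -/
noncomputable def monQuot (c : ι → ℝ) (j : ι) : MvPowerSeries σ ℝ →+ MvPowerSeries σ ℝ where
  toFun p := fun κ => if sel e (κ + e j) = some j then
    (c j)⁻¹ * MvPowerSeries.coeff (κ + e j) p else 0
  map_zero' := by
    ext κ
    show (if sel e (κ + e j) = some j then (c j)⁻¹ * (0 : ℝ) else 0) = 0
    simp
  map_add' p q := by
    ext κ
    show (if sel e (κ + e j) = some j then
        (c j)⁻¹ * (MvPowerSeries.coeff (κ + e j) p + MvPowerSeries.coeff (κ + e j) q) else 0) =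
      (if sel e (κ + e j) = some j then (c j)⁻¹ * MvPowerSeries.coeff (κ + e j) p else 0) +
      (if sel e (κ + e j) = some j then (c j)⁻¹ * MvPowerSeries.coeff (κ + e j) q else 0)
    split_ifs <;> ring

open Classical in
/-- The remainder in the division by the monomials `ξ^(e j)`. -/
noncomputable def monRem : MvPowerSeries σ ℝ →+ MvPowerSeries σ ℝ where
  toFun p := fun ν => if sel e ν = none then MvPowerSeries.coeff ν p else 0
  map_zero' := by
    ext κ
    show (if sel e κ = none then (0 : ℝ) else 0) = 0
    simp
  map_add' p q := by
    ext κ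
    show (if sel e κ = none then MvPowerSeries.coeff κ p + MvPowerSeries.coeff κ q else 0) =
      (if sel e κ = none then MvPowerSeries.coeff κ p else 0) +
      (if sel e κ = none then MvPowerSeries.coeff κ q else 0)
    split_ifs <;> ring

open Classical in
theorem coeff_monQuot (c : ι → ℝ) (j : ι) (p : MvPowerSeries σ ℝ) (κ : σ →₀ ℕ) :
    MvPowerSeries.coeff κ (monQuot e c j p) = if sel e (κ + e j) = some j then
    (c j)⁻¹ * MvPowerSeries.coeff (κ + e j) p else 0 := rfl

open Classical in
theorem coeff_monRem (p : MvPowerSeries σ ℝ) (ν : σ →₀ ℕ) :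
    MvPowerSeries.coeff ν (monRem e p) =
      if sel e ν = none then MvPowerSeries.coeff ν p else 0 := rfl

/-- `sel` sends each monomial of `p` to exactly one quotient or to the remainder, so nothing is
counted twice. -/
theorem eq_sum_monQuot [Fintype ι] {c : ι → ℝ} (hc : ∀ j, c j ≠ 0) (p : MvPowerSeries σ ℝ) :
    p = ∑ j, monQuot e c j p * MvPowerSeries.monomial (e j) (c j) + monRem e p := by
  classical
  ext ν
  rw [map_add, map_sum, coeff_monRem]
  have h : ∀ j, MvPowerSeries.coeff ν (monQuot e c j p * MvPowerSeries.monomial (e j) (c j)) =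
      if sel e ν = some j then MvPowerSeries.coeff ν p else 0 := by
    intro j
    rw [MvPowerSeries.coeff_mul_monomial]
    by_cases hj : e j ≤ ν
    · rw [if_pos hj, coeff_monQuot, tsub_add_cancel_of_le hj]
      split_ifs
      · field_simp [hc j]
      · simp
    · rw [if_neg hj, if_neg fun h => hj (le_of_sel e h)]
  simp only [h]
  cases hs : sel e ν with
  | none => simp
  | some j => simp

variable (W : MonomialWeight σ) (K : ℕ)

theorem wnorm_monQuot_le (c : ι → ℝ) (j : ι) (p : MvPowerSeries σ ℝ) :
    wnorm W K (monQuot e c j p) * (wt W K (e j) : ℝ≥0∞) ≤ ‖(c j)⁻¹‖ₑ * wnorm W K p := by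
  rw [wnorm, ← ENNReal.tsum_mul_right, wnorm, ← ENNReal.tsum_mul_left]
  refine le_trans (ENNReal.tsum_le_tsum fun κ => ?_) (ENNReal.tsum_comp_le_tsum_of_injective
    (add_left_injective (e j)) _)
  rw [coeff_monQuot, wt_add, ENNReal.coe_mul]
  split_ifs
  · rw [enorm_mul]
    exact le_of_eq (by ring)
  · simp

variable {W K}

theorem monQuot_mem_B (c : ι → ℝ) (j : ι) {p : MvPowerSeries σ ℝ} (hp : p ∈ B W K) :
    monQuot e c j p ∈ B W K := by
  have h := (wnorm_monQuot_le e W K c j p).trans_lt (ENNReal.mul_lt_top enorm_lt_top hp)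
  by_contra h'
  rw [mem_B, not_lt_top_iff] at h'
  rw [h', ENNReal.top_mul (by simpa using (wt_pos W K (e j)).ne')] at h
  exact lt_irrefl (⊤ : ℝ≥0∞) h

theorem monRem_mem_B {p : MvPowerSeries σ ℝ} (hp : p ∈ B W K) : monRem e p ∈ B W K := by
  refine mem_B_of_coeff hp fun ν => ?_
  rw [coeff_monRem]
  split_ifs <;> simp

/-- A monomial `κ` of the quotient has `W κ * W (e j) ≥ M`; replacing `W (e j)` by at least `W (e j)
+ 1` gains `W κ ≥ 1`. -/
theorem monQuot_mul_mem_weightGE (c : ι → ℝ) (j : ι) {p τ : MvPowerSeries σ ℝ} {M : ℕ}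
    (hp : p ∈ weightGE W M) (hτ : τ ∈ weightGE W (W (e j) + 1)) :
    monQuot e c j p * τ ∈ weightGE W (M + 1) := by
  classical
  intro ν hν
  rw [MvPowerSeries.coeff_mul]
  refine Finset.sum_eq_zero fun x hx => ?_
  have hx' : x.1 + x.2 = ν := Finset.HasAntidiagonal.mem_antidiagonal.1 hx
  by_contra h
  have h1 : ¬ W x.2 < W (e j) + 1 := fun h' => right_ne_zero_of_mul h (hτ _ h')
  have h2 := left_ne_zero_of_mul h
  rw [coeff_monQuot] at h2
  have h3 : ¬ W (x.1 + e j) < M := by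
    intro h'
    apply h2
    rw [hp _ h', mul_zero, ite_self]
  rw [W.map_add] at h3
  rw [← hx', W.map_add] at hν
  have := W.pos x.1
  have : W x.1 * (W (e j) + 1) ≤ W x.1 * W x.2 := Nat.mul_le_mul_left _ (by omega)
  rw [mul_add] at this
  omega

/-- Division of a power series by a finite family of series. -/
theorem exists_division [Fintype ι] {b : ι → MvPowerSeries σ ℝ} {K₀ : ℕ}
    (hb : ∀ j, b j ∈ B W K₀) (he : ∀ j, IsLeading W (b j) (e j)) :
    ∃ (R : MvPowerSeries σ ℝ → MvPowerSeries σ ℝ)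
      (Q : ι → MvPowerSeries σ ℝ → MvPowerSeries σ ℝ),
      (∀ p, p = ∑ j, Q j p * b j + R p) ∧
      (∀ p ν, MvPowerSeries.coeff ν (R p) ≠ 0 → ∀ j, ¬ e j ≤ ν) ∧
      R 0 = 0 ∧ (∀ j, Q j 0 = 0) ∧
      ∀ᶠ K in Filter.atTop, ∀ p ∈ B W K, R p ∈ B W K ∧ ∀ j, Q j p ∈ B W K := by
  classical
  let c : ι → ℝ := fun j => MvPowerSeries.coeff (e j) (b j)
  have hc : ∀ j, c j ≠ 0 := fun j => (he j).1
  let τ : ι → MvPowerSeries σ ℝ := fun j => tail (b j) (e j)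
  -- `E` is the error made by dividing by the `b j` as if they were their leading terms: `p + E p =
  -- ∑ monQuot p * b j + monRem p`. Inverting `1 + E` therefore gives an exact division.
  let E : MvPowerSeries σ ℝ →+ MvPowerSeries σ ℝ :=
    ∑ j, (AddMonoidHom.mulRight (τ j)).comp (monQuot e c j)
  have hE : ∀ p, E p = ∑ j, monQuot e c j p * τ j := fun p => by
    simp only [E, AddMonoidHom.finsetSum_apply]
    rfl
  obtain ⟨S, hS, hS0, hSn⟩ := exists_inverse_one_add W E (fun M p hp => by
    rw [hE]
    exact sum_mem fun j _ => monQuot_mul_mem_weightGE e c j hp (he j).tail_mem)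
  -- Chosen so that the `card ι` summands of `E` together have norm at most one half; the `+ 1`
  -- covers empty `ι`.
  let δ : ℝ≥0∞ := ((Fintype.card ι : ℝ≥0∞) + 1)⁻¹ * 2⁻¹
  have hδ : 0 < δ := by
    refine ENNReal.mul_pos (ENNReal.inv_ne_zero.2 ?_) (by simp)
    exact ENNReal.add_ne_top.2 ⟨ENNReal.natCast_ne_top _, ENNReal.one_ne_top⟩
  have hδ' : (Fintype.card ι : ℝ≥0∞) * δ ≤ 2⁻¹ := by
    rw [← mul_assoc]
    refine mul_le_of_le_one_left (by simp) ?_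
    rw [← ENNReal.div_eq_inv_mul.trans (mul_comm _ _)]
    exact ENNReal.div_le_of_le_mul (by simp)
  clear_value δ
  have hev : ∀ᶠ K in Filter.atTop, ∀ j,
      wnorm W K (τ j) ≤ ‖c j‖ₑ * δ * (wt W K (e j) : ℝ≥0∞) :=
    Filter.eventually_all.2 fun j => (he j).eventually_wnorm_tail_le (hb j)
      (ENNReal.mul_pos (by simpa using hc j) hδ.ne')
  refine ⟨fun p => monRem e (S p), fun j p => monQuot e c j (S p), fun p => ?_, fun p ν h => ?_,
    by simp [hS0], by simp [hS0], ?_⟩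
  · have h1 := hS p
    rw [hE] at h1
    conv_lhs => rw [← h1]
    nth_rewrite 1 [eq_sum_monQuot e hc (S p)]
    rw [add_right_comm, ← Finset.sum_add_distrib]
    congr 1
    refine Finset.sum_congr rfl fun j _ => ?_
    rw [← mul_add]
    congr 1
    exact add_sub_cancel _ _
  · rw [coeff_monRem] at h
    exact not_le_of_sel e (by by_contra h'; exact h (if_neg h'))
  · filter_upwards [hev] with K hK p hp
    have hSp : S p ∈ B W K := by
      refine (hSn K (fun p => ?_) p).trans_lt (ENNReal.mul_lt_top (by simp) hp)
      rw [hE]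
      calc _ ≤ ∑ j, wnorm W K (monQuot e c j p * τ j) := wnorm_sum_le W K _ _
        _ ≤ ∑ j : ι, δ * wnorm W K p := Finset.sum_le_sum fun j _ => ?_
        _ = (Fintype.card ι : ℝ≥0∞) * δ * wnorm W K p := by
          rw [Finset.sum_const, nsmul_eq_mul, Finset.card_univ, mul_assoc]
        _ ≤ _ := by gcongr
      have hcc : ‖c j‖ₑ * ‖(c j)⁻¹‖ₑ = 1 := by
        rw [← enorm_mul, mul_inv_cancel₀ (hc j), enorm_one]
      calc _ ≤ wnorm W K (monQuot e c j p) * wnorm W K (τ j) := wnorm_mul_le W K _ _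
        _ ≤ wnorm W K (monQuot e c j p) * (‖c j‖ₑ * δ * (wt W K (e j) : ℝ≥0∞)) := by
          gcongr; exact hK j
        _ = ‖c j‖ₑ * δ * (wnorm W K (monQuot e c j p) * (wt W K (e j) : ℝ≥0∞)) := by ring
        _ ≤ ‖c j‖ₑ * δ * (‖(c j)⁻¹‖ₑ * wnorm W K p) := by
          exact mul_le_mul_right (wnorm_monQuot_le e W K c j p) _
        _ = (‖c j‖ₑ * ‖(c j)⁻¹‖ₑ) * (δ * wnorm W K p) := by ring
        _ = δ * wnorm W K p := by rw [hcc, one_mul]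
    exact ⟨monRem_mem_B e hSp, fun j => monQuot_mem_B e c j hSp⟩

end FormalDivision

end AnalyticStructure

namespace AnalyticStructure

open scoped ENNReal NNReal Pointwise

/-! ### Division and inversion of Hahn series. -/

section HahnDivision

variable {Γ : Type*} [AddCommGroup Γ] [LinearOrder Γ]

variable (Γ) in
/-- A class of well ordered sets of exponents that is stable under the operations needed for
arithmetic with Hahn series. -/
structure SupportClass where
  /-- membership in the class -/
  mem : Set Γ → Prop
  isPWO : ∀ s, mem s → s.IsPWO
  mono : ∀ s t, s ⊆ t → mem t → mem s
  union : ∀ s t, mem s → mem t → mem (s ∪ t)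
  add : ∀ s t, mem s → mem t → mem (s + t)
  singleton : ∀ a, mem {a}
  closure : ∀ s, (∀ a ∈ s, 0 < a) → mem s → mem (AddSubmonoid.closure s : Set Γ)

theorem SupportClass.biUnion (F : SupportClass Γ) {ι : Type*} (t : Finset ι) {s : ι → Set Γ}
    (hs : ∀ i ∈ t, F.mem (s i)) : F.mem (⋃ i ∈ t, s i) := by
  classical
  induction t using Finset.induction_on with
  | empty => simpa using F.mono ∅ {0} (Set.empty_subset _) (F.singleton 0)
  | insert i t hi ih =>
    rw [Finset.set_biUnion_insert]
    exact F.union _ _ (hs i (Finset.mem_insert_self _ _))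
      (ih fun j hj => hs j (Finset.mem_insert_of_mem hj))

variable [IsOrderedAddMonoid Γ] {σ : Type*} (F : SupportClass Γ) (W : MonomialWeight σ) (K : ℕ)

/-- The Hahn series with support in the class `F` and coefficients in `B W K`. -/
noncomputable def RF : Subring (HahnSeries Γ (MvPowerSeries σ ℝ)) where
  carrier := {f | F.mem f.support ∧ ∀ γ, f.coeff γ ∈ B W K}
  mul_mem' := fun {f g} hf hg => ⟨F.mono _ _ HahnSeries.support_mul_subset (F.add _ _ hf.1 hg.1),
    fun γ => by
      rw [HahnSeries.coeff_mul]
      exact sum_mem fun x _ => mul_mem (hf.2 _) (hg.2 _)⟩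
  one_mem' := by
    refine ⟨F.mono _ {0} (fun γ hγ => ?_) (F.singleton 0), fun γ => ?_⟩
    · by_contra h
      exact hγ (by rw [HahnSeries.coeff_one, if_neg (by simpa using h)])
    · rw [HahnSeries.coeff_one]
      split_ifs
      exacts [one_mem _, zero_mem _]
  add_mem' := fun {f g} hf hg => ⟨F.mono _ _ (HahnSeries.support_add_subset _ _)
    (F.union _ _ hf.1 hg.1), fun γ => add_mem (hf.2 γ) (hg.2 γ)⟩
  zero_mem' := ⟨by simpa using F.mono ∅ {0} (Set.empty_subset _) (F.singleton 0),
    fun _ => zero_mem _⟩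
  neg_mem' := fun {f} hf => ⟨by simpa using hf.1, fun γ => neg_mem (hf.2 γ)⟩

/-- The elements of `RF F W K` of norm at most one. -/
noncomputable def RFInt : Subring (HahnSeries Γ (MvPowerSeries σ ℝ)) :=
  RF F W K ⊓ unitBall Γ (MvPowerSeries σ ℝ)

theorem RF_mono : Monotone (RF F W (Γ := Γ)) := fun _ _ h _ hf =>
  ⟨hf.1, fun γ => B_mono W h (hf.2 γ)⟩

theorem RFInt_mono : Monotone (RFInt F W (Γ := Γ)) := fun _ _ h _ hf => ⟨RF_mono F W h hf.1, hf.2⟩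

/-- The sum at `γ` only involves `y` at elements of `T` strictly below `γ`. So `y` is built on `T`
by well-founded recursion, and the formula then defines it on all of `Γ`. -/
theorem exists_recursion {V : Type*} [AddCommGroup V] {T P : Set Γ} (hT : T.IsPWO) (hP : P.IsPWO)
    (hpos : ∀ a ∈ P, 0 < a) (h : Γ → V) (G : Γ → V → V) :
    ∃ y : Γ → V, ∀ γ, y γ = h γ - ∑ x ∈ Finset.antidiagonal hT hP γ, G x.2 (y x.1) := by
  have hwf : WellFounded (fun a b : T => a.1 < b.1) := hT.isWF
  have hlt : ∀ γ, ∀ x ∈ Finset.antidiagonal hT hP γ, x.1 ∈ T ∧ x.1 < γ := by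
    intro γ x hx
    obtain ⟨h1, h2, h3⟩ := Finset.mem_antidiagonal.1 hx
    exact ⟨h1, h3 ▸ lt_add_of_pos_right _ (hpos _ h2)⟩
  let step : ∀ γ : T, (∀ b : T, b.1 < γ.1 → V) → V := fun γ f =>
    h γ - ∑ x ∈ (Finset.antidiagonal hT hP γ.1).attach,
      G x.1.2 (f ⟨x.1.1, (hlt _ _ x.2).1⟩ (hlt _ _ x.2).2)
  let z : T → V := hwf.fix step
  have hz : ∀ γ : T, z γ = step γ fun b _ => z b := fun γ => hwf.fix_eq step γ
  let y : Γ → V := fun γ => h γ - ∑ x ∈ (Finset.antidiagonal hT hP γ).attach,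
      G x.1.2 (z ⟨x.1.1, (hlt _ _ x.2).1⟩)
  have hy : ∀ γ : T, y γ = z γ := fun γ => (hz γ).symm
  refine ⟨y, fun γ => ?_⟩
  rw [← Finset.sum_attach]
  show h γ - _ = _
  congr 1
  refine Finset.sum_congr rfl fun x _ => ?_
  rw [← hy]

variable {F W}

/-- Divide by the coefficients of `t^0`, exponent by exponent, after subtracting what the positive
exponents of the `g j` contribute. The same `Q` and `R` are used at every exponent, so the polydisc
does not shrink along the recursion. -/
theorem hahn_division {ι : Type*} [Fintype ι] (e : ι → σ →₀ ℕ)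
    {g : ι → HahnSeries Γ (MvPowerSeries σ ℝ)} {K₀ : ℕ} (hg : ∀ j, g j ∈ RFInt F W K₀)
    (he : ∀ j, IsLeading W ((g j).coeff 0) (e j)) :
    ∀ᶠ K in Filter.atTop, ∀ h ∈ RFInt F W K,
      ∃ (q : ι → HahnSeries Γ (MvPowerSeries σ ℝ)) (r : HahnSeries Γ (MvPowerSeries σ ℝ)),
        (∀ j, q j ∈ RFInt F W K) ∧ r ∈ RFInt F W K ∧ h = ∑ j, q j * g j + r ∧
        ∀ γ ν, MvPowerSeries.coeff ν (r.coeff γ) ≠ 0 → ∀ j, ¬ e j ≤ ν := by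
  classical
  obtain ⟨R, Q, hdiv, hR, hR0, hQ0, hev⟩ := exists_division e (fun j => (hg j).1.2 0) he
  filter_upwards [hev, Filter.eventually_ge_atTop K₀] with K hK hKK₀ h hh
  let P : Set Γ := ⋃ j ∈ (Finset.univ : Finset ι), ((g j).support \ {0})
  have hPF : F.mem P := F.biUnion _ fun j _ => F.mono _ _ Set.sdiff_subset (hg j).1.1
  have hgP : ∀ j, ∀ γ, γ ≠ 0 → (g j).coeff γ ≠ 0 → γ ∈ P := fun j γ h0 h1 =>
    Set.mem_biUnion (Finset.mem_univ j) ⟨h1, h0⟩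
  have hpos : ∀ a ∈ P, 0 < a := by
    intro a ha
    simp only [P, Set.mem_iUnion] at ha
    obtain ⟨j, -, h1, h2⟩ := ha
    refine lt_of_le_of_ne (le_of_not_gt fun h3 => h1 ((hg j).2 a h3)) (Ne.symm h2)
  let M := AddSubmonoid.closure P
  have hMF : F.mem (M : Set Γ) := F.closure P hpos hPF
  have hM0 : ∀ a ∈ M, 0 ≤ a := fun a ha =>
    (AddSubmonoid.closure_le (S := AddSubmonoid.nonneg Γ)).2 (fun b hb => (hpos b hb).le) ha
  -- Contains the support of `h` and is stable under adding elements of `P`, hence contains every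
  -- exponent the recursion can produce.
  let T : Set Γ := h.support + (M : Set Γ)
  have hTF : F.mem T := F.add _ _ hh.1.1 hMF
  have hT := F.isPWO _ hTF
  have hP := F.isPWO _ hPF
  have hT0 : ∀ a ∈ T, 0 ≤ a := by
    rintro _ ⟨a, ha, b, hb, rfl⟩
    exact add_nonneg (le_of_not_gt fun h3 => ha (hh.2 a h3)) (hM0 b hb)
  have hTP : ∀ a ∈ T, ∀ b ∈ P, a + b ∈ T := by
    rintro _ ⟨a, ha, c, hc, rfl⟩ b hb
    exact ⟨a, ha, c + b, M.add_mem hc (AddSubmonoid.subset_closure hb), (add_assoc _ _ _).symm⟩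
  have hhT : ∀ γ, γ ∉ T → h.coeff γ = 0 := by
    intro γ hγ
    by_contra h'
    exact hγ ⟨γ, h', 0, M.zero_mem, add_zero γ⟩
  obtain ⟨y, hy⟩ := exists_recursion hT hP hpos h.coeff
    (fun γ v => ∑ j, Q j v * (g j).coeff γ)
  have hyT : ∀ γ, γ ∉ T → y γ = 0 := by
    intro γ hγ
    rw [hy γ, hhT γ hγ, zero_sub, neg_eq_zero]
    refine Finset.sum_eq_zero fun x hx => ?_
    obtain ⟨h1, h2, h3⟩ := Finset.mem_antidiagonal.1 hx
    exact absurd (h3 ▸ hTP _ h1 _ h2) hγ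
  have hyB : ∀ γ, y γ ∈ B W K := by
    intro γ
    by_cases hγ : γ ∈ T
    · refine hT.isWF.induction hγ (P := fun γ => y γ ∈ B W K) fun γ hγ ih => ?_
      rw [hy γ]
      refine sub_mem (hh.1.2 γ) (sum_mem fun x hx => sum_mem fun j _ => ?_)
      obtain ⟨h1, h2, h3⟩ := Finset.mem_antidiagonal.1 hx
      exact mul_mem ((hK _ (ih _ h1 (h3 ▸ lt_add_of_pos_right _ (hpos _ h2)))).2 j)
        (B_mono W hKK₀ ((hg j).1.2 _))
    · rw [hyT γ hγ]
      exact zero_mem _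
  have hsupp : ∀ f : MvPowerSeries σ ℝ → MvPowerSeries σ ℝ, f 0 = 0 →
      Function.support (fun γ => f (y γ)) ⊆ T := by
    intro f hf γ hγ
    by_contra h'
    exact hγ (by simp only [hyT γ h', hf])
  let mk : ∀ f : MvPowerSeries σ ℝ → MvPowerSeries σ ℝ, f 0 = 0 →
      HahnSeries Γ (MvPowerSeries σ ℝ) := fun f hf => ⟨fun γ => f (y γ), hT.mono (hsupp f hf)⟩
  have hmk : ∀ f hf, (∀ p ∈ B W K, f p ∈ B W K) → mk f hf ∈ RFInt F W K := by
    refine fun f hf hB => ⟨⟨F.mono _ _ (hsupp f hf) hTF, fun γ => hB _ (hyB γ)⟩, fun γ hγ => ?_⟩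
    show f (y γ) = 0
    rw [hyT γ fun h' => absurd (hT0 γ h') (not_le.2 hγ), hf]
  refine ⟨fun j => mk (Q j) (hQ0 j), mk R hR0, fun j => hmk (Q j) (hQ0 j)
    fun p hp => (hK p hp).2 j, hmk R hR0 fun p hp => (hK p hp).1, ?_, fun γ ν => hR (y γ) ν⟩
  have hmul : ∀ j γ, (mk (Q j) (hQ0 j) * g j).coeff γ = Q j (y γ) * (g j).coeff 0 +
      ∑ x ∈ Finset.antidiagonal hT hP γ, Q j (y x.1) * (g j).coeff x.2 := by
    intro j γ
    -- Splitting off the `t^0` term leaves a series supported in `P`, which matches the sum in the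
    -- recursion.
    let g' := g j - HahnSeries.single 0 ((g j).coeff 0)
    have h1 : g j = HahnSeries.single 0 ((g j).coeff 0) + g' := by simp [g']
    have h2 : ∀ a, a ≠ 0 → g'.coeff a = (g j).coeff a := by
      intro a ha
      simp [g', HahnSeries.coeff_single_of_ne ha]
    have h3 : g'.support ⊆ P := by
      intro a ha
      have ha0 : a ≠ 0 := by
        rintro rfl
        exact ha (by simp [g'])
      exact hgP j a ha0 (by rw [← h2 a ha0]; exact ha)
    conv_lhs => rw [h1]
    rw [mul_add, HahnSeries.coeff_add, HahnSeries.coeff_mul_single_zero,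
      HahnSeries.coeff_mul_left' (x := mk (Q j) (hQ0 j)) hT (hsupp (Q j) (hQ0 j))]
    congr 1
    refine Finset.sum_subset_zero_on_sdiff (Finset.antidiagonal_mono_right h3) ?_ ?_
    · intro x hx
      rw [Finset.mem_sdiff, Finset.mem_antidiagonal, Finset.mem_antidiagonal] at hx
      have h0 : g'.coeff x.2 = 0 := by
        by_contra h4
        exact hx.2 ⟨hx.1.1, h4, hx.1.2.2⟩
      rw [← h2 _ (hpos _ hx.1.2.1).ne', h0, mul_zero]
    · intro x hx
      have h4 := h3 (Finset.mem_antidiagonal.1 hx).2.1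
      rw [h2 _ (hpos _ h4).ne']
  ext1
  funext γ
  rw [HahnSeries.coeff_add, HahnSeries.coeff_sum]
  simp only [hmul]
  rw [Finset.sum_add_distrib, Finset.sum_comm, add_right_comm]
  show _ = _ + R (y γ) + _
  rw [← hdiv (y γ)]
  conv_rhs => rw [hy γ]
  rw [sub_add_cancel]

/-- A series whose coefficient of `t^0` has nonzero constant term becomes a unit of norm one after
shrinking the polydisc. -/
theorem eventually_exists_inverse {u : HahnSeries Γ (MvPowerSeries σ ℝ)} {K₀ : ℕ}
    (hu : u ∈ RFInt F W K₀) (h0 : MvPowerSeries.coeff 0 (u.coeff 0) ≠ 0) :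
    ∀ᶠ K in Filter.atTop, ∃ v ∈ RFInt F W K, v * u = 1 := by
  have hlead : IsLeading W (u.coeff 0) 0 := by
    refine ⟨h0, fun ν hν => absurd hν (not_lt.2 ?_)⟩
    have h1 : W 0 = 1 := by
      have h2 := W.map_add 0 0
      rw [add_zero] at h2
      exact Nat.eq_of_mul_eq_mul_left (W.pos 0) (by rw [← h2, mul_one])
    rw [h1]
    exact W.pos ν
  -- Divide `1` by `u`: the leading monomial is `1`, which divides every monomial, so the remainder
  -- vanishes.
  filter_upwards [hahn_division (ι := Unit) (fun _ => 0) (fun _ => hu) (fun _ => hlead)]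
    with K hK
  obtain ⟨q, r, hq, -, h1, hr⟩ := hK 1 (one_mem _)
  have hr0 : r = 0 := by
    ext γ ν
    by_contra h'
    exact hr γ ν h' () zero_le
  refine ⟨q (), hq _, ?_⟩
  rw [h1, hr0]
  simp

end HahnDivision

end AnalyticStructure

namespace AnalyticStructure

/-! ### Homogeneous parts, the module they span, and the units. -/

section Graded

variable {σ D : Type*} [AddCommMonoid D] (deg : (σ →₀ ℕ) →+ D)

open Classical in
/-- The part of a power series consisting of the monomials with degree in `T`. -/
noncomputable def part (T : Set D) : MvPowerSeries σ ℝ →+ MvPowerSeries σ ℝ where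
  toFun p := fun ν => if deg ν ∈ T then MvPowerSeries.coeff ν p else 0
  map_zero' := by
    ext ν
    show (if deg ν ∈ T then (0 : ℝ) else 0) = 0
    simp
  map_add' p q := by
    ext ν
    show (if deg ν ∈ T then MvPowerSeries.coeff ν p + MvPowerSeries.coeff ν q else 0) =
      (if deg ν ∈ T then MvPowerSeries.coeff ν p else 0) +
      (if deg ν ∈ T then MvPowerSeries.coeff ν q else 0)
    split_ifs <;> ring

open Classical in
theorem coeff_part (T : Set D) (p : MvPowerSeries σ ℝ) (ν : σ →₀ ℕ) :
    MvPowerSeries.coeff ν (part deg T p) = if deg ν ∈ T then MvPowerSeries.coeff ν p else 0 := rfl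

/-- Multiplication by a homogeneous `y` shifts all degrees by `κ`. Arbitrary sets of degrees are
needed since `D` has no subtraction. -/
theorem part_mul_of_homogeneous (T : Set D) (a y : MvPowerSeries σ ℝ) {κ : D}
    (hy : ∀ ν, MvPowerSeries.coeff ν y ≠ 0 → deg ν = κ) :
    part deg T (a * y) = part deg {d | d + κ ∈ T} a * y := by
  classical
  ext ν
  rw [coeff_part, MvPowerSeries.coeff_mul, MvPowerSeries.coeff_mul]
  have h : ∀ x ∈ Finset.HasAntidiagonal.antidiagonal ν,
      MvPowerSeries.coeff x.1 (part deg {d | d + κ ∈ T} a) * MvPowerSeries.coeff x.2 y =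
      if deg ν ∈ T then MvPowerSeries.coeff x.1 a * MvPowerSeries.coeff x.2 y else 0 := by
    intro x hx
    have hx' : x.1 + x.2 = ν := Finset.HasAntidiagonal.mem_antidiagonal.1 hx
    by_cases h0 : MvPowerSeries.coeff x.2 y = 0
    · simp [h0]
    · rw [coeff_part, ← hx', map_add, hy _ h0, Set.mem_ofPred_eq, ite_mul, zero_mul]
  rw [Finset.sum_congr rfl h]
  split_ifs <;> simp

variable {Γ : Type*} [LinearOrder Γ]

/-- The part of a Hahn series consisting of the monomials with degree in `T`. -/
noncomputable def hPart (T : Set D) :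
    HahnSeries Γ (MvPowerSeries σ ℝ) →+ HahnSeries Γ (MvPowerSeries σ ℝ) where
  toFun f := f.map (part deg T)
  map_zero' := by ext; simp
  map_add' f g := by ext; simp

theorem coeff_hPart (T : Set D) (f : HahnSeries Γ (MvPowerSeries σ ℝ)) (γ : Γ) :
    (hPart deg T f).coeff γ = part deg T (f.coeff γ) := rfl

theorem hPart_homogeneous (κ : D) (f : HahnSeries Γ (MvPowerSeries σ ℝ)) (γ : Γ) (ν : σ →₀ ℕ)
    (h : MvPowerSeries.coeff ν ((hPart deg {κ} f).coeff γ) ≠ 0) : deg ν = κ := by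
  classical
  rw [coeff_hPart, coeff_part] at h
  by_contra h'
  exact h (if_neg h')

theorem hPart_support_subset (T : Set D) (f : HahnSeries Γ (MvPowerSeries σ ℝ)) :
    (hPart deg T f).support ⊆ f.support := by
  intro γ h h'
  exact h (by rw [coeff_hPart, h', map_zero])

theorem eq_hPart_compl_add_sum (J : Finset D) (f : HahnSeries Γ (MvPowerSeries σ ℝ)) :
    f = hPart deg (J : Set D)ᶜ f + ∑ μ ∈ J, hPart deg {μ} f := by
  classical
  ext γ ν
  rw [HahnSeries.coeff_add, HahnSeries.coeff_sum, map_add, map_sum]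
  simp only [coeff_hPart, coeff_part, Set.mem_compl_iff, Finset.mem_coe, Set.mem_singleton_iff]
  rw [Finset.sum_ite_eq]
  by_cases h : deg ν ∈ J <;> simp [h]

variable [AddCommGroup Γ] [IsOrderedAddMonoid Γ]

theorem hPart_mul_of_homogeneous (T : Set D) (a y : HahnSeries Γ (MvPowerSeries σ ℝ)) {κ : D}
    (hy : ∀ γ ν, MvPowerSeries.coeff ν (y.coeff γ) ≠ 0 → deg ν = κ) :
    hPart deg T (a * y) = hPart deg {d | d + κ ∈ T} a * y := by
  ext1
  funext γ
  rw [coeff_hPart, HahnSeries.coeff_mul, HahnSeries.coeff_mul_left' a.isPWO_support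
    (hPart_support_subset deg _ a), map_sum]
  refine Finset.sum_congr rfl fun x _ => ?_
  rw [part_mul_of_homogeneous deg T _ _ (hy x.2), coeff_hPart]

theorem hPart_single_mul (T : Set D) (δ : Γ) (f : HahnSeries Γ (MvPowerSeries σ ℝ)) :
    hPart deg T (HahnSeries.single δ 1 * f) = HahnSeries.single δ 1 * hPart deg T f := by
  ext1
  funext γ
  rw [coeff_hPart, HahnSeries.coeff_single_mul, HahnSeries.coeff_single_mul, coeff_hPart, one_mul,
    one_mul]

variable (F : SupportClass Γ) (W : MonomialWeight σ)

theorem part_mem_B (T : Set D) {K : ℕ} {p : MvPowerSeries σ ℝ} (hp : p ∈ B W K) :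
    part deg T p ∈ B W K := by
  classical
  refine mem_B_of_coeff hp fun ν => ?_
  rw [coeff_part]
  split_ifs <;> simp

variable {F W}

theorem hPart_mem_RF (T : Set D) {K : ℕ} {f : HahnSeries Γ (MvPowerSeries σ ℝ)}
    (hf : f ∈ RF F W K) : hPart deg T f ∈ RF F W K :=
  ⟨F.mono _ _ (hPart_support_subset deg T f) hf.1, fun γ => part_mem_B deg W T (hf.2 γ)⟩

theorem hPart_mem_RFInt (T : Set D) {K : ℕ} {f : HahnSeries Γ (MvPowerSeries σ ℝ)}
    (hf : f ∈ RFInt F W K) : hPart deg T f ∈ RFInt F W K :=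
  ⟨hPart_mem_RF deg T hf.1, fun γ hγ => by rw [coeff_hPart, hf.2 γ hγ, map_zero]⟩

variable (F W) in
/-- The `RFInt F W K`-module generated by the homogeneous parts of `f`. -/
noncomputable def partSpan (f : HahnSeries Γ (MvPowerSeries σ ℝ)) (K : ℕ) :
    Submodule (RFInt F W K) (HahnSeries Γ (MvPowerSeries σ ℝ)) :=
  Submodule.span (RFInt F W K) (Set.range fun μ : D => hPart deg {μ} f)

variable {f : HahnSeries Γ (MvPowerSeries σ ℝ)}

theorem mul_mem_partSpan {K : ℕ} {a x : HahnSeries Γ (MvPowerSeries σ ℝ)} (ha : a ∈ RFInt F W K)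
    (hx : x ∈ partSpan deg F W f K) : a * x ∈ partSpan deg F W f K :=
  (partSpan deg F W f K).smul_mem ⟨a, ha⟩ hx

theorem hPart_mem_partSpan (K : ℕ) (μ : D) : hPart deg {μ} f ∈ partSpan deg F W f K :=
  Submodule.subset_span ⟨μ, rfl⟩

theorem partSpan_mono {K K' : ℕ} (h : K ≤ K') {x : HahnSeries Γ (MvPowerSeries σ ℝ)}
    (hx : x ∈ partSpan deg F W f K) : x ∈ partSpan deg F W f K' := by
  induction hx using Submodule.span_induction with
  | mem x hx => exact Submodule.subset_span hx
  | zero => exact zero_mem _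
  | add x y _ _ hx hy => exact add_mem hx hy
  | smul a x _ hx => exact mul_mem_partSpan deg (RFInt_mono F W h a.2) hx

/-- The generators are homogeneous, so taking a part of `a * f_κ` only replaces the coefficient `a`
by one of its own parts. -/
theorem hPart_of_mem_partSpan (T : Set D) {K : ℕ} {x : HahnSeries Γ (MvPowerSeries σ ℝ)}
    (hx : x ∈ partSpan deg F W f K) : hPart deg T x ∈ partSpan deg F W f K := by
  -- Scalars must multiply generators only: the shift of degrees is available for homogeneous
  -- factors, not for general elements of the span.
  induction hx using Submodule.closure_induction with
  | zero => rw [map_zero]; exact zero_mem _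
  | add x y _ _ hx hy => rw [map_add]; exact add_mem hx hy
  | smul_mem a x hx =>
    obtain ⟨κ, rfl⟩ := hx
    show hPart deg T (a.1 * _) ∈ _
    rw [hPart_mul_of_homogeneous deg T _ _ (hPart_homogeneous deg κ f)]
    exact mul_mem_partSpan deg (hPart_mem_RFInt deg _ a.2) (hPart_mem_partSpan deg K κ)

theorem single_mem_RF (K : ℕ) (γ : Γ) : HahnSeries.single γ 1 ∈ RF F W K := by
  classical
  refine ⟨F.mono _ _ HahnSeries.support_single_subset (F.singleton γ), fun δ => ?_⟩
  rw [HahnSeries.coeff_single]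
  split_ifs
  exacts [one_mem _, zero_mem _]

theorem single_mem_RFInt (K : ℕ) {γ : Γ} (hγ : 0 ≤ γ) : HahnSeries.single γ 1 ∈ RFInt F W K :=
  ⟨single_mem_RF K γ, fun _ hδ => HahnSeries.coeff_single_of_ne (hδ.trans_le hγ).ne⟩

theorem exists_eq_single_mul {K : ℕ} {r : HahnSeries Γ (MvPowerSeries σ ℝ)} (hr : r ∈ RF F W K) :
    ∃ r' ∈ RFInt F W K, r = HahnSeries.single r.order 1 * r' ∧
      ∀ γ, r'.coeff γ = r.coeff (γ + r.order) := by
  have h1 : ∀ γ, (HahnSeries.single (-r.order) 1 * r).coeff γ = r.coeff (γ + r.order) := by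
    intro γ
    rw [HahnSeries.coeff_single_mul, one_mul, sub_neg_eq_add]
  refine ⟨HahnSeries.single (-r.order) 1 * r, ⟨mul_mem (single_mem_RF K _) hr, fun γ hγ => ?_⟩,
    ?_, h1⟩
  · rw [h1]
    exact HahnSeries.coeff_eq_zero_of_lt_order (by simpa using hγ)
  · rw [← mul_assoc, HahnSeries.single_mul_single, add_neg_cancel, one_mul,
      HahnSeries.single_zero_one, one_mul]

/-- The inductive form of `exists_mem_partSpan`: modulo the span, `f` is `t^γ h`, and the `t^(c j) g
j` already lie in the span. The ideal `I` of leading monomials only serves for termination; its ring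
is Noetherian. -/
theorem exists_mem_partSpan_of_sub_mem [Finite σ] (I : Ideal (MvPolynomial σ ℚ)) :
    ∀ {ι : Type} [Fintype ι] (e : ι → σ →₀ ℕ) (g : ι → HahnSeries Γ (MvPowerSeries σ ℝ))
      (c : ι → Γ) (K : ℕ) (γ : Γ) (h : HahnSeries Γ (MvPowerSeries σ ℝ)),
      I = Ideal.span ((fun ν => MvPolynomial.monomial ν 1) '' Set.range e) →
      (∀ j, g j ∈ RFInt F W K) → (∀ j, IsLeading W ((g j).coeff 0) (e j)) →
      (∀ j, HahnSeries.single (c j) 1 * g j ∈ partSpan deg F W f K) → (∀ j, c j ≤ γ) →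
      h ∈ RFInt F W K → f - HahnSeries.single γ 1 * h ∈ partSpan deg F W f K →
      ∃ K, f ∈ partSpan deg F W f K := by
  classical
  induction I using WellFoundedGT.induction with
  | ind I ih =>
  intro ι _ e g c K γ h hI hg he hgf hc hh hf
  obtain ⟨K', hdiv, hKK'⟩ :=
    ((hahn_division e hg he).and (Filter.eventually_ge_atTop K)).exists
  obtain ⟨q, r, hq, hr, hsum, hrν⟩ := hdiv h (RFInt_mono F W hKK' hh)
  have hfr : f - HahnSeries.single γ 1 * r ∈ partSpan deg F W f K' := by
    have h1 : f - HahnSeries.single γ 1 * r = (f - HahnSeries.single γ 1 * h) +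
        ∑ j, (HahnSeries.single (γ - c j) 1 * q j) * (HahnSeries.single (c j) 1 * g j) := by
      have h2 : ∀ j, (HahnSeries.single (γ - c j) 1 * q j) * (HahnSeries.single (c j) 1 * g j) =
          HahnSeries.single γ 1 * (q j * g j) := by
        intro j
        -- The invariant `c j ≤ γ` is used here: the scalar `t^(γ - c j)` has norm at most one.
        have h3 : (HahnSeries.single γ (1 : MvPowerSeries σ ℝ)) =
            HahnSeries.single (γ - c j) 1 * HahnSeries.single (c j) 1 := by
          rw [HahnSeries.single_mul_single, sub_add_cancel, one_mul]
        rw [h3]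
        ring
      simp only [h2]
      rw [← Finset.mul_sum, eq_sub_of_add_eq hsum.symm]
      ring
    rw [h1]
    refine add_mem (partSpan_mono deg hKK' hf) (sum_mem fun j _ => mul_mem_partSpan deg
      (mul_mem (single_mem_RFInt K' (sub_nonneg.2 (hc j))) (hq j))
      (partSpan_mono deg hKK' (hgf j)))
  by_cases hr0 : r = 0
  · refine ⟨K', ?_⟩
    simpa [hr0] using hfr
  obtain ⟨r', hr', hrr', hcoeff⟩ := exists_eq_single_mul hr.1
  have hδ : 0 ≤ r.order := by
    by_contra h'
    exact HahnSeries.coeff_order_eq_zero.not.2 hr0 (hr.2 _ (not_le.1 h'))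
  have hr'0 : r'.coeff 0 ≠ 0 := by
    rw [hcoeff, zero_add]
    exact HahnSeries.coeff_order_eq_zero.not.2 hr0
  obtain ⟨ν, hν⟩ := exists_isLeading W hr'0
  have hνe : ∀ j, ¬ e j ≤ ν := hrν (0 + r.order) ν (by rw [← hcoeff]; exact hν.1)
  have hfr' : f - HahnSeries.single (γ + r.order) 1 * r' ∈ partSpan deg F W f K' := by
    have h3 : HahnSeries.single (γ + r.order) 1 * r' = HahnSeries.single γ 1 * r := by
      conv_rhs => rw [hrr']
      rw [← mul_assoc, HahnSeries.single_mul_single, one_mul]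
    rwa [h3]
  -- The new divisor is a homogeneous part of `r'`, not `r'` itself: it keeps the leading monomial
  -- `ν`, and up to `t^(γ + r.order)` it is congruent to a generator of the span, hence lies in the
  -- span.
  let g' := hPart deg {deg ν} r'
  have hlead : IsLeading W (g'.coeff 0) ν := by
    refine ⟨?_, fun κ hκ => ?_⟩
    · simp only [g', coeff_hPart, coeff_part]
      rw [if_pos (Set.mem_singleton _)]
      exact hν.1
    · simp only [g', coeff_hPart, coeff_part]
      rw [hν.2 κ hκ, ite_self]
  have hg'f : HahnSeries.single (γ + r.order) 1 * g' ∈ partSpan deg F W f K' := by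
    rw [← hPart_single_mul]
    have h4 := sub_mem (hPart_mem_partSpan deg (F := F) (W := W) (f := f) K' (deg ν))
      (hPart_of_mem_partSpan deg {deg ν} hfr')
    rwa [map_sub, sub_sub_cancel] at h4
  let e' : Option ι → σ →₀ ℕ := fun o => o.elim ν e
  refine ih (Ideal.span ((fun ν => MvPolynomial.monomial ν 1) '' Set.range e')) ?_ e'
    (fun o => o.elim g' g) (fun o => o.elim (γ + r.order) c) K' (γ + r.order) r' rfl
    ?_ ?_ ?_ ?_ hr' hfr'
  · rw [hI]
    -- The ideal grows strictly: a monomial lies in a monomial ideal only if a generator divides it,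
    -- and no `e j` divides `ν`.
    refine gt_iff_lt.2 <| lt_of_le_not_ge (Ideal.span_mono (Set.image_mono ?_)) fun hle => ?_
    · rintro _ ⟨j, rfl⟩
      exact ⟨some j, rfl⟩
    · have h5 : MvPolynomial.monomial ν (1 : ℚ) ∈
          Ideal.span ((fun ν => MvPolynomial.monomial ν (1 : ℚ)) '' Set.range e) :=
        hle (Ideal.subset_span ⟨ν, ⟨none, rfl⟩, rfl⟩)
      rw [MvPolynomial.mem_ideal_span_monomial_image] at h5
      obtain ⟨_, ⟨j, rfl⟩, hj⟩ := h5 ν (by simp [MvPolynomial.support_monomial])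
      exact hνe j hj
  · rintro (_ | j)
    exacts [hPart_mem_RFInt deg _ hr', RFInt_mono F W hKK' (hg j)]
  · rintro (_ | j)
    exacts [hlead, he j]
  · rintro (_ | j)
    exacts [hg'f, partSpan_mono deg hKK' (hgf j)]
  · rintro (_ | j)
    exacts [le_rfl, (hc j).trans (le_add_of_nonneg_right hδ)]

theorem exists_mem_partSpan [Finite σ] {K : ℕ} (hf : f ∈ RF F W K) :
    ∃ K, f ∈ partSpan deg F W f K := by
  obtain ⟨h, hh, hfh, -⟩ := exists_eq_single_mul hf
  -- The start has no divisors, and `f = t^(f.order) h` exactly.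
  refine exists_mem_partSpan_of_sub_mem deg _ (ι := Empty) (fun j => j.elim) (fun j => j.elim)
    (fun j => j.elim) K f.order h rfl (fun j => j.elim) (fun j => j.elim) (fun j => j.elim)
    (fun j => j.elim) hh ?_
  rw [← hfh, sub_self]
  exact zero_mem _

theorem exists_eq_sum_hPart_mul_unit [Finite σ] {K : ℕ} (hf : f ∈ RF F W K) :
    ∃ (K : ℕ) (J : Finset D) (u v : D → HahnSeries Γ (MvPowerSeries σ ℝ)),
      (∀ μ, u μ ∈ RFInt F W K) ∧ (∀ μ, v μ ∈ RFInt F W K) ∧ (∀ μ, v μ * u μ = 1) ∧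
      f = ∑ μ ∈ J, hPart deg {μ} f * u μ := by
  classical
  obtain ⟨K₁, hK₁⟩ := exists_mem_partSpan deg hf
  obtain ⟨a, ha⟩ := Finsupp.mem_span_range_iff_exists_finsupp.1 hK₁
  let J := a.support
  -- For `μ ∈ J` the degree `0` is excluded here, since `0 + μ ∈ J`; so `b μ` has no constant term.
  let b : D → HahnSeries Γ (MvPowerSeries σ ℝ) := fun μ =>
    hPart deg {d | d + μ ∈ (J : Set D)ᶜ} (a μ).1
  have hfJ : f = ∑ μ ∈ J, hPart deg {μ} f * (1 + b μ) := by
    conv_lhs => rw [eq_hPart_compl_add_sum deg J f]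
    have h1 : hPart deg (J : Set D)ᶜ f = ∑ μ ∈ J, b μ * hPart deg {μ} f := by
      conv_lhs => rw [← ha]
      rw [Finsupp.sum, map_sum]
      refine Finset.sum_congr rfl fun μ _ => ?_
      exact hPart_mul_of_homogeneous deg _ _ _ (hPart_homogeneous deg μ f)
    rw [h1, ← Finset.sum_add_distrib]
    exact Finset.sum_congr rfl fun μ _ => by ring
  have hb : ∀ μ, b μ ∈ RFInt F W K₁ := fun μ => hPart_mem_RFInt deg _ (a μ).2
  have hb0 : ∀ μ ∈ J, MvPowerSeries.coeff 0 ((1 + b μ).coeff 0) ≠ 0 := by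
    intro μ hμ
    have h2 : MvPowerSeries.coeff 0 ((b μ).coeff 0) = 0 := by
      simp only [b, coeff_hPart, coeff_part]
      rw [if_neg]
      simpa using hμ
    rw [HahnSeries.coeff_add, map_add, h2, HahnSeries.coeff_one, if_pos rfl]
    simp
  -- Finiteness of `J` provides one `K` that works for all the inverses.
  have hev : ∀ᶠ K in Filter.atTop, ∀ μ ∈ J, ∃ v ∈ RFInt F W K, v * (1 + b μ) = 1 :=
    (Filter.eventually_all_finset J).2 fun μ hμ =>
      eventually_exists_inverse (add_mem (one_mem _) (hb μ)) (hb0 μ hμ)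
  obtain ⟨K₂, hinv, hK⟩ := (hev.and (Filter.eventually_ge_atTop K₁)).exists
  choose! v hv hvu using hinv
  refine ⟨K₂, J, fun μ => if μ ∈ J then 1 + b μ else 1, fun μ => if μ ∈ J then v μ else 1,
    fun μ => ?_, fun μ => ?_, fun μ => ?_, ?_⟩
  · dsimp only
    split_ifs
    exacts [add_mem (one_mem _) (RFInt_mono F W hK (hb μ)), one_mem _]
  · dsimp only
    split_ifs with h
    exacts [hv μ h, one_mem _]
  · dsimp only
    split_ifs with h
    exacts [hvu μ h, one_mul 1]
  · conv_lhs => rw [hfJ]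
    exact Finset.sum_congr rfl fun μ hμ => by simp only [if_pos hμ]

end Graded

end AnalyticStructure

/-! ### The two support classes and the expansion in powers of `η`. -/

namespace AnalyticStructure

open scoped Pointwise

/-- The class of all well ordered sets. -/
def wellOrderedClass (Γ : Type*) [AddCommGroup Γ] [LinearOrder Γ] [IsOrderedAddMonoid Γ] :
    SupportClass Γ where
  mem s := s.IsPWO
  isPWO _ h := h
  mono _ _ h ht := ht.mono h
  union _ _ hs ht := hs.union ht
  add _ _ hs ht := hs.add ht
  singleton a := Set.isPWO_singleton a
  closure _ hpos hs := hs.addSubmonoid_closure fun a ha => (hpos a ha).le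

theorem isPWO_of_finite_lt {s : Set ℚ} (hs : ∀ c : ℚ, {γ | γ ∈ s ∧ γ < c}.Finite) : s.IsPWO := by
  refine Set.IsWF.isPWO ?_
  rw [Set.isWF_iff_no_descending_seq]
  intro f hf hfs
  refine (hs (f 0 + 1)).not_infinite ?_
  refine (Set.infinite_range_of_injective hf.injective).mono ?_
  rintro _ ⟨n, rfl⟩
  exact ⟨hfs n, (hf.antitone (Nat.zero_le n)).trans_lt (lt_add_one _)⟩

theorem finite_lt_add {s t : Set ℚ} (hs : ∀ c : ℚ, {γ | γ ∈ s ∧ γ < c}.Finite)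
    (ht : ∀ c : ℚ, {γ | γ ∈ t ∧ γ < c}.Finite) (c : ℚ) : {γ | γ ∈ s + t ∧ γ < c}.Finite := by
  have hb : ∀ {u : Set ℚ}, (∀ c : ℚ, {γ | γ ∈ u ∧ γ < c}.Finite) → ∃ b, ∀ a ∈ u, b ≤ a := by
    intro u hu
    obtain ⟨b, hb⟩ := (hu 0).bddBelow
    refine ⟨min b 0, fun a ha => ?_⟩
    rcases lt_or_ge a 0 with h | h
    exacts [(min_le_left _ _).trans (hb ⟨ha, h⟩), (min_le_right _ _).trans h]
  obtain ⟨b₁, h₁⟩ := hb hs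
  obtain ⟨b₂, h₂⟩ := hb ht
  refine ((hs (c - b₂)).add (ht (c - b₁))).subset ?_
  rintro _ ⟨⟨x, hx, y, hy, rfl⟩, hc⟩
  have := h₁ x hx
  have := h₂ y hy
  simp only at hc
  exact ⟨x, ⟨hx, by linarith⟩, y, ⟨hy, by linarith⟩, rfl⟩

/-- A nonempty `s` has a least element `ε > 0`. A nonzero element of the monoid below `(k + 1) ε` is
`x + y` with `x ∈ s` and `y` in the monoid below `k ε`, so induction on `k` applies. -/
theorem finite_lt_closure {s : Set ℚ} (hpos : ∀ a ∈ s, 0 < a)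
    (hs : ∀ c : ℚ, {γ | γ ∈ s ∧ γ < c}.Finite) (c : ℚ) :
    {γ | γ ∈ (AddSubmonoid.closure s : Set ℚ) ∧ γ < c}.Finite := by
  obtain ⟨ε, hε, hεs⟩ : ∃ ε : ℚ, 0 < ε ∧ ∀ a ∈ s, ε ≤ a := by
    rcases s.eq_empty_or_nonempty with rfl | hne
    · exact ⟨1, one_pos, by simp⟩
    · have hwf := (isPWO_of_finite_lt hs).isWF
      exact ⟨hwf.min hne, hpos _ (hwf.min_mem hne), fun a ha => hwf.min_le hne ha⟩
  have key : ∀ k : ℕ, {γ | γ ∈ (AddSubmonoid.closure s : Set ℚ) ∧ γ < k * ε}.Finite := by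
    intro k
    induction k with
    | zero =>
      refine Set.finite_empty.subset ?_
      rintro γ ⟨h1, h2⟩
      have : 0 ≤ γ := (AddSubmonoid.closure_le (S := AddSubmonoid.nonneg ℚ)).2
        (fun b hb => (hpos b hb).le) h1
      simp at h2
      exact absurd h2 (not_lt.2 this)
    | succ k ih =>
      refine (((hs ((k + 1) * ε)).add ih).union (Set.finite_singleton 0)).subset ?_
      rintro γ ⟨h1, h2⟩
      push_cast at h2
      induction h1 using AddSubmonoid.closure_induction_left with
      | zero => exact Or.inr rfl
      | add_left x hx y hy _ =>
        have h3 := hεs x hx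
        have h4 : 0 ≤ y := (AddSubmonoid.closure_le (S := AddSubmonoid.nonneg ℚ)).2
          (fun b hb => (hpos b hb).le) hy
        exact Or.inl ⟨x, ⟨hx, by linarith⟩, y, ⟨hy, by linarith⟩, rfl⟩
  obtain ⟨k, hk⟩ := exists_nat_gt (c / ε)
  refine (key k).subset fun γ h => ⟨h.1, h.2.trans ?_⟩
  rwa [div_lt_iff₀ hε] at hk

/-- The class of sets of rational numbers with finitely many elements below every bound. -/
def leftFiniteClass : SupportClass ℚ where
  mem s := ∀ c : ℚ, {γ | γ ∈ s ∧ γ < c}.Finite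
  isPWO _ h := isPWO_of_finite_lt h
  mono _ _ h ht c := (ht c).subset fun _ hγ => ⟨h hγ.1, hγ.2⟩
  union _ _ hs ht c := ((hs c).union (ht c)).subset fun _ hγ =>
    hγ.1.elim (fun h => Or.inl ⟨h, hγ.2⟩) (fun h => Or.inr ⟨h, hγ.2⟩)
  add _ _ hs ht := finite_lt_add hs ht
  singleton a _ := (Set.finite_singleton a).subset fun _ hγ => hγ.1
  closure _ hpos hs := finite_lt_closure hpos hs

section Expansion

variable {m n : ℕ}

/-- The exponent of `η` in a monomial in `ξ` and `η`. -/
noncomputable def etaDegree (m n : ℕ) : (Fin m ⊕ Fin n →₀ ℕ) →+ (Fin n →₀ ℕ) :=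
  (AddMonoidHom.snd _ _).comp Finsupp.sumFinsuppAddEquivProdFinsupp.toAddMonoidHom

theorem etaDegree_sumElim (κ : Fin m →₀ ℕ) (μ : Fin n →₀ ℕ) :
    etaDegree m n (κ.sumElim μ) = μ := by
  ext i
  rfl

theorem exists_eq_sumElim (ν : Fin m ⊕ Fin n →₀ ℕ) :
    ∃ (κ : Fin m →₀ ℕ) (μ : Fin n →₀ ℕ), ν = κ.sumElim μ :=
  ⟨(Finsupp.sumFinsuppEquivProdFinsupp ν).1, (Finsupp.sumFinsuppEquivProdFinsupp ν).2,
    (Finsupp.sumFinsuppEquivProdFinsupp.symm_apply_apply ν).symm⟩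

theorem coeff_rename_inl_sumElim_zero (p : MvPowerSeries (Fin m) ℝ) (κ : Fin m →₀ ℕ) :
    MvPowerSeries.coeff (κ.sumElim (0 : Fin n →₀ ℕ))
      (MvPowerSeries.rename (Sum.inl : Fin m → Fin m ⊕ Fin n) p) = MvPowerSeries.coeff κ p := by
  have h := MvPowerSeries.coeff_embDomain_rename
    (Function.Embedding.inl : Fin m ↪ Fin m ⊕ Fin n) p κ
  rwa [Finsupp.embDomain_inl] at h

theorem coeff_rename_inl_sumElim_of_ne (p : MvPowerSeries (Fin m) ℝ) (κ : Fin m →₀ ℕ)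
    {μ : Fin n →₀ ℕ} (hμ : μ ≠ 0) :
    MvPowerSeries.coeff (κ.sumElim μ)
      (MvPowerSeries.rename (Sum.inl : Fin m → Fin m ⊕ Fin n) p) = 0 := by
  refine MvPowerSeries.coeff_rename_eq_zero _ _ ?_
  rintro ⟨x, hx⟩
  apply hμ
  ext i
  have := DFunLike.congr_fun hx (Sum.inr i)
  rw [Finsupp.mapDomain_of_notMem_range _ _ (by simp)] at this
  exact this.symm

variable {Γ : Type*} [AddCommGroup Γ] [LinearOrder Γ] [IsOrderedAddMonoid Γ]

/-- Translates the abstract grading into the expansion: the homogeneous parts for `etaDegree` are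
the terms `f̄_μ(ξ) η^μ`. -/
theorem hPart_etaDegree (μ : Fin n →₀ ℕ)
    (f : HahnSeries Γ (MvPowerSeries (Fin m ⊕ Fin n) ℝ)) :
    hPart (etaDegree m n) {μ} f = inXi n (etaCoeff μ f) * etaPow Γ m μ := by
  classical
  ext γ ν
  obtain ⟨κ, μ', rfl⟩ := exists_eq_sumElim ν
  rw [coeff_hPart, coeff_part, etaDegree_sumElim, Set.mem_singleton_iff, etaPow,
    HahnSeries.C_apply, HahnSeries.coeff_mul_single_zero, MvPowerSeries.coeff_mul_monomial,
    mul_one]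
  have hsub : κ.sumElim μ' - (0 : Fin m →₀ ℕ).sumElim μ = κ.sumElim (μ' - μ) := by
    ext (i | i) <;> simp
  have hle : (0 : Fin m →₀ ℕ).sumElim μ ≤ κ.sumElim μ' ↔ μ ≤ μ' := by
    constructor
    · intro h i
      exact h (Sum.inr i)
    · rintro h (i | i)
      exacts [Nat.zero_le _, h i]
  rw [hsub]
  simp only [hle]
  by_cases h : μ' = μ
  · subst h
    rw [if_pos rfl, if_pos le_rfl, tsub_self]
    exact (coeff_rename_inl_sumElim_zero ((etaCoeff μ' f).coeff γ) κ).symm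
  · rw [if_neg h]
    split_ifs with h'
    · refine (coeff_rename_inl_sumElim_of_ne ((etaCoeff μ f).coeff γ) κ fun h0 => h ?_).symm
      exact le_antisymm (tsub_eq_zero_iff_le.1 h0) h'
    · rfl

/-- The sum for `f̄_μ` at radius `ρ` is a subsum of that for `f`, divided by `ρ ^ |μ|`; no shrinking
is needed. -/
theorem etaCoeff_mem_RG {α : ℝ} (hα : 0 < α)
    {f : HahnSeries Γ (MvPowerSeries (Fin m ⊕ Fin n) ℝ)}
    (hf : f ∈ RG Γ (Fin m ⊕ Fin n) α) (μ : Fin n →₀ ℕ) : etaCoeff μ f ∈ RG Γ (Fin m) α := by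
  intro γ
  obtain ⟨ρ, hρ, hs⟩ := hf γ
  have hρ0 : (ρ : ℝ) ≠ 0 := (hα.trans hρ).ne'
  have hinj : Function.Injective fun κ : Fin m →₀ ℕ => κ.sumElim μ := by
    intro κ κ' h
    ext i
    exact DFunLike.congr_fun h (Sum.inl i)
  refine ⟨ρ, hρ, ((hs.comp_injective hinj).mul_left (((ρ : ℝ) ^ μ.degree)⁻¹)).congr fun κ => ?_⟩
  have hdeg : (κ.sumElim μ).degree = κ.degree + μ.degree := by
    simp [Finsupp.degree_eq_sum]
  rw [coeff_coeff_etaCoeff, Function.comp_apply, hdeg, pow_add]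
  field_simp

/-- The strong Noetherian property for series with support in a given class. -/
theorem exists_eq_sum_etaCoeff_mul_unit (F : SupportClass Γ) {α : ℝ} (hα : 0 < α)
    {f : HahnSeries Γ (MvPowerSeries (Fin m ⊕ Fin n) ℝ)} (hf : f ∈ RG Γ (Fin m ⊕ Fin n) α)
    (hF : F.mem f.support) :
    ∃ (d : ℕ) (β : ℝ) (J : Finset (Fin n →₀ ℕ))
      (u v : (Fin n →₀ ℕ) → HahnSeries Γ (MvPowerSeries (Fin m ⊕ Fin n) ℝ)),
      0 < β ∧ β ≤ α ∧ (∀ μ ∈ J, ∀ i, μ i ≤ d) ∧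
      (∀ μ, u μ ∈ RGInt Γ (Fin m ⊕ Fin n) β ∧ F.mem (u μ).support) ∧
      (∀ μ, v μ ∈ RGInt Γ (Fin m ⊕ Fin n) β ∧ F.mem (v μ).support) ∧
      (∀ μ, v μ * u μ = 1) ∧
      f = ∑ μ ∈ J, inXi n (etaCoeff μ f) * etaPow Γ m μ * u μ := by
  obtain ⟨W⟩ := exists_monomialWeight (Fin m ⊕ Fin n)
  obtain ⟨K₀, hK₀⟩ := exists_A_le_B W hα
  obtain ⟨K, J, u, v, hu, hv, hvu, hsum⟩ := exists_eq_sum_hPart_mul_unit (F := F) (W := W)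
    (etaDegree m n) (K := K₀) (f := f) ⟨hF, fun γ => hK₀ (hf γ)⟩
  obtain ⟨β, hβ, hβα, hB⟩ := exists_B_le_A W K hα
  have hle : ∀ x ∈ RFInt F W K, x ∈ RGInt Γ (Fin m ⊕ Fin n) β ∧ F.mem x.support :=
    fun x hx => ⟨⟨fun γ => hB (hx.1.2 γ), hx.2⟩, hx.1.1⟩
  refine ⟨J.sup fun μ => Finset.univ.sup μ, β, J, u, v, hβ, hβα, fun μ hμ i => ?_,
    fun μ => hle _ (hu μ), fun μ => hle _ (hv μ), hvu, ?_⟩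
  · exact (Finset.le_sup (f := μ) (Finset.mem_univ i)).trans
      (Finset.le_sup (f := fun μ : Fin n →₀ ℕ => Finset.univ.sup μ) hμ)
  · simpa only [hPart_etaDegree] using hsum

end Expansion

end AnalyticStructure

theorem mainTheorem7 :
    (∀ (m n : ℕ) (α : ℝ), 0 < α →
      ∀ f ∈ AnalyticStructure.R (Fin m ⊕ Fin n) α,
        (∀ μ : Fin n →₀ ℕ,
          AnalyticStructure.etaCoeff μ f ∈ AnalyticStructure.R (Fin m) α) ∧
        ∃ (d : ℕ) (β : ℝ) (J : Finset (Fin n →₀ ℕ))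
          (U : (Fin n →₀ ℕ) → (AnalyticStructure.RInt (Fin m ⊕ Fin n) β)ˣ),
          0 < β ∧ β ≤ α ∧ (∀ μ ∈ J, ∀ i, μ i ≤ d) ∧
          f = ∑ μ ∈ J, AnalyticStructure.inXi n (AnalyticStructure.etaCoeff μ f) *
            AnalyticStructure.etaPow ℚ m μ * (U μ).val.val) ∧
    (∀ (G : Type*) [AddCommGroup G] [LinearOrder G] [IsOrderedAddMonoid G]
      (m n : ℕ) (α : ℝ), 0 < α →
      ∀ f ∈ AnalyticStructure.RG G (Fin m ⊕ Fin n) α,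
        (∀ μ : Fin n →₀ ℕ,
          AnalyticStructure.etaCoeff μ f ∈ AnalyticStructure.RG G (Fin m) α) ∧
        ∃ (d : ℕ) (β : ℝ) (J : Finset (Fin n →₀ ℕ))
          (U : (Fin n →₀ ℕ) → (AnalyticStructure.RGInt G (Fin m ⊕ Fin n) β)ˣ),
          0 < β ∧ β ≤ α ∧ (∀ μ ∈ J, ∀ i, μ i ≤ d) ∧
          f = ∑ μ ∈ J, AnalyticStructure.inXi n (AnalyticStructure.etaCoeff μ f) *
            AnalyticStructure.etaPow G m μ * (U μ).val.val) := by
  refine ⟨fun m n α hα f hf => ⟨fun μ => ?_, ?_⟩, fun G _ _ _ m n α hα f hf => ⟨fun μ => ?_, ?_⟩⟩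
  · exact ⟨AnalyticStructure.etaCoeff_mem_RG hα hf.1 μ, AnalyticStructure.leftFiniteClass.mono _ _
      (HahnSeries.support_map_subset _ _) hf.2⟩
  · obtain ⟨d, β, J, u, v, hβ, hβα, hJ, hu, hv, hvu, hsum⟩ :=
      AnalyticStructure.exists_eq_sum_etaCoeff_mul_unit AnalyticStructure.leftFiniteClass hα hf.1 hf.2
    exact ⟨d, β, J, fun μ => ⟨⟨u μ, ⟨(hu μ).1.1, (hu μ).2⟩, (hu μ).1.2⟩,
      ⟨v μ, ⟨(hv μ).1.1, (hv μ).2⟩, (hv μ).1.2⟩,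
      Subtype.ext ((mul_comm _ _).trans (hvu μ)), Subtype.ext (hvu μ)⟩, hβ, hβα, hJ, hsum⟩
  · exact AnalyticStructure.etaCoeff_mem_RG hα hf μ
  · obtain ⟨d, β, J, u, v, hβ, hβα, hJ, hu, hv, hvu, hsum⟩ :=
      AnalyticStructure.exists_eq_sum_etaCoeff_mul_unit (AnalyticStructure.wellOrderedClass G) hα hf
        f.isPWO_support
    exact ⟨d, β, J, fun μ => ⟨⟨u μ, (hu μ).1⟩, ⟨v μ, (hv μ).1⟩,
      Subtype.ext ((mul_comm _ _).trans (hvu μ)), Subtype.ext (hvu μ)⟩, hβ, hβα, hJ, hsum⟩
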